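/- Conventions. All digraphs are finite and may have multiple arcs. Series parallel digraphs (SPDs) are digraphs $G$ with an ordered pair $(s,t)$ of terminals (source and sink) defined inductively: a single arc from $s$ to $t$ with vertex set $\{s,t\}$, $s\neq t$, is an SPD; and if $(G_1,(s_1,t_1))$ and $(G_2,(s_2,t_2))$ are SPDs, then so are their series composition (take the disjoint union, identify $t_1$ with $s_2$, terminals $(s_1,t_2)$) and their parallel composition (take the disjoint union, identify $s_1$ with $s_2$ and $t_1$ with $t_2$, these two vertices being the terminals). A topological order of $G$ is an enumeration $v_1,\dots,v_n$ of all vertices of $G$ without repetition in which the tail of every arc precedes its head. Its cut-size sequence is the integer sequence $x(1),\dots,x(n-1)$ where $x(i)$ is the number of arcs (counted with multiplicity) with tail in $\{v_1,\dots,v_i\}$ and head in $\{v_{i+1},\dots,v_n\}$. An extension of an integer sequence is obtained by repeating each of its entries an arbitrary number of times, at least once. A sequence $r$ dominates a sequence $s$ if there are extensions $r^*$ of $r$ and $s^*$ of $s$ of the same length with $r^*(i)\le s^*(i)$ for all $i$; $r$ dominates a set of sequences if it dominates each of its elements. A non-diagonal merge of $r=r(1),\dots,r(m)$ and $s=s(1),\dots,s(n)$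 is a sequence $r(i_1)+s(j_1),\dots,r(i_\ell)+s(j_\ell)$ with $(i_1,j_1)=(1,1)$, $(i_\ell,j_\ell)=(m,n)$ and $(i_{k+1},j_{k+1})\in\{(i_k+1,j_k),(i_k,j_k+1)\}$ for all $k<\ell$. Statement. Let $G$ be an SPD without parallel arcs. Then there is a topological order $\pi^*$ of $G$ whose cut-size sequence dominates the cut-size sequences of all topological orders of $G$. Moreover, let $G_1$ and $G_2$ be SPDs and, for $r\in\{1,2\}$, let $\pi_r^*$ be a topological order of $G_r$ whose cut-size sequence $\sigma(\pi_r^*)$ dominates the cut-size sequences of all topological orders of $G_r$. 1. If $G$ is the series composition of $G_1$ and $G_2$, then the concatenation of $\pi_1^*$ and $\pi_2^*$, in which the identified vertex $t_1=s_2$ appears only once, is a topological order of $G$ whose cut-size sequence dominates the cut-size sequences of all topological orders of $G$. 2. If $G$ is the parallel composition of $G_1$ and $G_2$, then there is a topological order of $G$ whose cut-size sequence dominates all non-diagonal merges of $\sigma(\pi_1^*)$ and $\sigma(\pi_2^*)$, and the cut-size sequence of every topological order of $G$ with this property dominates the cut-size sequences of all topological orders of $G$. -/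

import Mathlib

universe u

/-- A two-terminal multidigraph with vertex set `V`: a multiset of arcs (an arc `(u, v)` is directed
from its tail `u` to its head `v`) and an ordered pair of terminals. -/
structure TerminalDigraph (V : Type u) where
  arcs : Multiset (V × V)
  source : V
  sink : V

namespace TerminalDigraph

variable {V V₁ V₂ : Type u}

/-- `G` is a single arc directed from its source to its sink. -/
def IsSingleArc (G : TerminalDigraph V) : Prop :=
  G.source ≠ G.sink ∧ (∀ v : V, v = G.source ∨ v = G.sink) ∧ G.arcs = {(G.source, G.sink)}

/-- `G` is the series composition of `G₁` and `G₂`: it is obtained from their disjoint union by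
identifying the sink of `G₁` with the source of `G₂` (and nothing else). The maps `f₁`, `f₂` send a
vertex of `G₁`, `G₂` to the vertex of `G` that it becomes. -/
structure IsSeriesComp (G₁ : TerminalDigraph V₁) (G₂ : TerminalDigraph V₂) (G : TerminalDigraph V)
    (f₁ : V₁ → V) (f₂ : V₂ → V) : Prop where
  injective_left : Function.Injective f₁
  injective_right : Function.Injective f₂
  covers : ∀ v : V, (∃ x, f₁ x = v) ∨ (∃ y, f₂ y = v)
  identified_iff : ∀ x y, f₁ x = f₂ y ↔ x = G₁.sink ∧ y = G₂.source
  arcs_eq : G.arcs = G₁.arcs.map (Prod.map f₁ f₁) + G₂.arcs.map (Prod.map f₂ f₂)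
  source_eq : G.source = f₁ G₁.source
  sink_eq : G.sink = f₂ G₂.sink

/-- `G` is the parallel composition of `G₁` and `G₂`: it is obtained from their disjoint union by
identifying the two sources and identifying the two sinks (and nothing else). -/
structure IsParallelComp (G₁ : TerminalDigraph V₁) (G₂ : TerminalDigraph V₂)
    (G : TerminalDigraph V) (f₁ : V₁ → V) (f₂ : V₂ → V) : Prop where
  injective_left : Function.Injective f₁
  injective_right : Function.Injective f₂
  covers : ∀ v : V, (∃ x, f₁ x = v) ∨ (∃ y, f₂ y = v)
  identified_iff : ∀ x y, f₁ x = f₂ y ↔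
    (x = G₁.source ∧ y = G₂.source) ∨ (x = G₁.sink ∧ y = G₂.sink)
  arcs_eq : G.arcs = G₁.arcs.map (Prod.map f₁ f₁) + G₂.arcs.map (Prod.map f₂ f₂)
  source_eq : G.source = f₁ G₁.source
  sink_eq : G.sink = f₁ G₁.sink

/-- Series parallel digraphs. -/
inductive IsSPD : {V : Type u} → TerminalDigraph V → Prop
  | arc {V : Type u} (G : TerminalDigraph V) (h : G.IsSingleArc) : IsSPD G
  | series {V₁ V₂ V : Type u} (G₁ : TerminalDigraph V₁) (G₂ : TerminalDigraph V₂)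
      (G : TerminalDigraph V) (f₁ : V₁ → V) (f₂ : V₂ → V) (h₁ : IsSPD G₁) (h₂ : IsSPD G₂)
      (h : IsSeriesComp G₁ G₂ G f₁ f₂) : IsSPD G
  | parallel {V₁ V₂ V : Type u} (G₁ : TerminalDigraph V₁) (G₂ : TerminalDigraph V₂)
      (G : TerminalDigraph V) (f₁ : V₁ → V) (f₂ : V₂ → V) (h₁ : IsSPD G₁) (h₂ : IsSPD G₂)
      (h : IsParallelComp G₁ G₂ G f₁ f₂) : IsSPD G

/-- No two arcs have the same tail and the same head. -/
def NoParallelArcs (G : TerminalDigraph V) : Prop := G.arcs.Nodup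

open Classical in
/-- A linear order of the vertices is given as the list `v₁, …, vₙ` of all of them without
repetition; it is topological if the tail of every arc comes before its head. -/
def IsTopologicalOrder (G : TerminalDigraph V) (τ : List V) : Prop :=
  τ.Nodup ∧ (∀ v : V, v ∈ τ) ∧ ∀ a ∈ G.arcs, τ.idxOf a.1 < τ.idxOf a.2

open Classical in
/-- The cut-size sequence of `τ = v₁, …, vₙ`, of length `n - 1`: its entries count, with
multiplicity, the arcs whose tail is at or before a position and whose head is after it.
Positions are counted from `0` here. -/
noncomputable def cutSizeSeq (G : TerminalDigraph V) (τ : List V) : List ℤ :=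
  (List.range (τ.length - 1)).map fun i =>
    ((G.arcs.countP fun a => τ.idxOf a.1 ≤ i ∧ i < τ.idxOf a.2 : ℕ) : ℤ)

end TerminalDigraph

/-- The extensions of `s`: every entry is repeated some number of times, at least once. -/
def extensions (s : List ℤ) : Set (List ℤ) :=
  {e | ∃ k : List ℕ, k.length = s.length ∧ (∀ m ∈ k, 1 ≤ m) ∧
    e = (List.zipWith List.replicate k s).flatten}

/-- `r` dominates `s`: some extensions of them have the same length and satisfy `r' ≤ s'` entry by
entry. -/
def Dominates (r s : List ℤ) : Prop :=
  ∃ r' ∈ extensions r, ∃ s' ∈ extensions s, List.Forall₂ (· ≤ ·) r' s'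

/-- `IsNonDiagonalMerge r s t`: the sequence `t` is a non-diagonal merge of `r` and `s`, i.e. the
sequence of the sums `r i + s j` along a path of index pairs from the pair of first indices to the
pair of last indices, each step of which increases exactly one of the two indices, by one. -/
inductive IsNonDiagonalMerge : List ℤ → List ℤ → List ℤ → Prop
  | single (a b : ℤ) : IsNonDiagonalMerge [a] [b] [a + b]
  | stepLeft (a a' b : ℤ) (r s t : List ℤ) (h : IsNonDiagonalMerge (a' :: r) (b :: s) t) :
      IsNonDiagonalMerge (a :: a' :: r) (b :: s) ((a + b) :: t)
  | stepRight (a b b' : ℤ) (r s t : List ℤ) (h : IsNonDiagonalMerge (a :: r) (b' :: s) t) :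
      IsNonDiagonalMerge (a :: r) (b :: b' :: s) ((a + b) :: t)

/-- The set of all non-diagonal merges of `r` and `s`. -/
def nonDiagonalMerges (r s : List ℤ) : Set (List ℤ) := {t | IsNonDiagonalMerge r s t}

/-- `r` dominates every sequence in the set `S`. -/
def DominatesSet (r : List ℤ) (S : Set (List ℤ)) : Prop := ∀ s ∈ S, Dominates r s

namespace TerminalDigraph

variable {V V₁ V₂ : Type u}

/-- The set of the cut-size sequences of all topological orders of `G`. -/
def cutSizeSeqs (G : TerminalDigraph V) : Set (List ℤ) :=
  {x | ∃ τ, G.IsTopologicalOrder τ ∧ x = G.cutSizeSeq τ}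

/-- `τ` is a topological order of `G` whose cut-size sequence dominates all cut-size sequences of
`G`. -/
def IsDominatingOrder (G : TerminalDigraph V) (τ : List V) : Prop :=
  G.IsTopologicalOrder τ ∧ DominatesSet (G.cutSizeSeq τ) G.cutSizeSeqs

/-- The concatenation of an order of `G₁` and an order of `G₂` in a series composition, in which
the identified vertex (last in the first order, first in the second) is listed only once. -/
def concatOrder (f₁ : V₁ → V) (f₂ : V₂ → V) (τ₁ : List V₁) (τ₂ : List V₂) : List V :=
  τ₁.map f₁ ++ (τ₂.map f₂).tail

end TerminalDigraph

/-! Domination of nonempty sequences amounts to a monotone walk through pairs of positions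
(`WalkDominates`). In this form it is transitive and compatible with concatenation (`append`),
reversal (`reverse`) and merging (`IsNonDiagonalMerge.mono`).

In a series composition the identified vertex comes after all other vertices of the first part and
before all other vertices of the second. Hence every topological order is a concatenation, its
cut-size sequence is the concatenation of the two cut-size sequences, and dominating orders can be
chosen separately in the parts.

In a parallel composition the interiors of the parts are shuffled freely, and cut sizes add. So the
cut-size sequences of the composition are exactly the non-diagonal merges of cut-size sequences of
the parts. By monotonicity of merging, the merges of the two dominating sequences suffice.

It remains to see that any two nonempty sequences have a merge dominating all their merges
(`hasDominatingMerge`). If a sequence returns to the level of its head, its entries before the first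
return form a descent. If both sequences return, the descent with the smaller rise may be performed
first at no loss, since any merge must climb at least as high before it can profit from the other
sequence; if only one returns, the other never falls below its head and the same holds. Removing the
descent shortens the problem. If neither sequence returns, the same argument applies to the reversed
sequences, unless both have a single entry. -/

/-! ### Domination as a monotone walk -/

/-- There is a monotone walk through the pairs of positions of `r` and `s`, from the pair of first
positions to the pair of last positions, which advances one coordinate at a time and visits only
pairs with `r i ≤ s j`. -/
inductive WalkDominates : List ℤ → List ℤ → Prop
  | single {a b : ℤ} (hab : a ≤ b) : WalkDominates [a] [b]
  | left {a a' b : ℤ} {r s : List ℤ} (hab : a ≤ b) (h : WalkDominates (a' :: r) (b :: s)) :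
      WalkDominates (a :: a' :: r) (b :: s)
  | right {a b b' : ℤ} {r s : List ℤ} (hab : a ≤ b) (h : WalkDominates (a :: r) (b' :: s)) :
      WalkDominates (a :: r) (b :: b' :: s)

namespace WalkDominates

theorem ne_nil {r s : List ℤ} (h : WalkDominates r s) : r ≠ [] ∧ s ≠ [] := by
  cases h <;> simp

theorem head_le {a b : ℤ} {r s : List ℤ} (h : WalkDominates (a :: r) (b :: s)) : a ≤ b := by
  cases h <;> assumption

/-- A diagonal step can be replaced by two axis steps. If the corner `(a, b')` is not admissible,
then `b' < a ≤ b`, and the corner `(a', b)` is admissible because `a' ≤ b'`. -/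
theorem cons {a b : ℤ} {r s : List ℤ} (hab : a ≤ b) (h : WalkDominates r s) :
    WalkDominates (a :: r) (b :: s) := by
  obtain ⟨hr, hs⟩ := h.ne_nil
  obtain ⟨a', r, rfl⟩ := List.exists_cons_of_ne_nil hr
  obtain ⟨b', s, rfl⟩ := List.exists_cons_of_ne_nil hs
  by_cases hc : a ≤ b'
  · exact right hab (left hc h)
  · exact left hab (right (by linarith [h.head_le]) h)

theorem refl {r : List ℤ} (hr : r ≠ []) : WalkDominates r r := by
  induction r with
  | nil => exact absurd rfl hr
  | cons a r ih =>
    cases r with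
    | nil => exact single le_rfl
    | cons b r => exact cons le_rfl (ih (by simp))

/-- The two walks are run together, synchronized on the position in `s`, whose current entry
separates those of `r` and `t`. -/
theorem trans {r s t : List ℤ} (h₁ : WalkDominates r s) (h₂ : WalkDominates s t) :
    WalkDominates r t := by
  induction h₁ generalizing t with
  | @single a b hab =>
    generalize hs : [b] = s at h₂
    induction h₂ with
    | single h => cases hs; exact single (hab.trans h)
    | left h _ _ => cases hs
    | right h _ ih => cases hs; exact right (hab.trans h) (ih rfl)
  | @left a a' b r s hab _ ih =>
    cases h₂ with
    | single h => exact left (hab.trans h) (ih (single h))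
    | left h h' => exact left (hab.trans h) (ih (left h h'))
    | right h h' => exact left (hab.trans h) (ih (right h h'))
  | @right a b b' r s hab _ ih =>
    generalize hs : b :: b' :: s = s' at h₂
    induction h₂ with
    | single h => cases hs
    | left h h' _ => cases hs; exact ih h'
    | right h _ ih' => cases hs; exact right (hab.trans h) (ih' rfl)

theorem append {r s r' s' : List ℤ} (h : WalkDominates r s) (h' : WalkDominates r' s') :
    WalkDominates (r ++ r') (s ++ s') := by
  induction h with
  | single hab => exact cons hab h'
  | left hab _ ih => exact left hab ih
  | right hab _ ih => exact right hab ih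

theorem prepend (r : List ℤ) {s t : List ℤ} (h : WalkDominates s t) :
    WalkDominates (r ++ s) (r ++ t) := by
  cases r with
  | nil => exact h
  | cons a r => exact append (refl (by simp)) h

theorem stutter_left (r : List ℤ) (c : ℤ) (s : List ℤ) :
    WalkDominates (r ++ c :: c :: s) (r ++ c :: s) :=
  prepend r (left le_rfl (refl (by simp)))

theorem stutter_right (r : List ℤ) (c : ℤ) (s : List ℤ) :
    WalkDominates (r ++ c :: s) (r ++ c :: c :: s) :=
  prepend r (right le_rfl (refl (by simp)))

theorem reverse {r s : List ℤ} (h : WalkDominates r s) :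
    WalkDominates r.reverse s.reverse := by
  induction h with
  | single hab => exact single hab
  | @left a a' b r s hab _ ih =>
    rw [List.reverse_cons (a := a)]
    -- Appending a pair repeats the last entry of the sequence that did not advance; the repetition
    -- is then absorbed.
    refine (ih.append (single hab)).trans ?_
    simpa using stutter_left s.reverse b []
  | @right a b b' r s hab _ ih =>
    rw [List.reverse_cons (a := b)]
    refine trans ?_ (ih.append (single hab))
    simpa using stutter_right r.reverse a []

/-- The walk waits at `m` while it passes through `l`. -/
theorem prepend_le {m : ℤ} {l r s : List ℤ} (hl : ∀ x ∈ l, x ≤ m)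
    (h : WalkDominates r (m :: s)) : WalkDominates (l ++ r) (m :: s) := by
  induction l with
  | nil => exact h
  | cons a l ih =>
    have h' := ih fun x hx => hl x (by simp [hx])
    obtain ⟨b, t, hb⟩ := List.exists_cons_of_ne_nil h'.ne_nil.1
    rw [List.cons_append, hb]
    exact left (hl a (by simp)) (hb ▸ h')

theorem single_of_forall_le {a : ℤ} {s : List ℤ} (hs : s ≠ []) (h : ∀ x ∈ s, a ≤ x) :
    WalkDominates [a] s := by
  induction s with
  | nil => exact absurd rfl hs
  | cons b s ih =>
    cases s with
    | nil => exact single (h b (by simp))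
    | cons c s =>
      exact right (h b (by simp)) (ih (by simp) fun x hx => h x (List.mem_cons_of_mem _ hx))

/-- Two dominations can be joined at a common entry `m` of the dominated sequence, where the
dominating sequence may in addition pass through any entries that are at most `m`. -/
theorem join {m : ℤ} {r l r' s s' : List ℤ} (h : WalkDominates r (s ++ [m]))
    (hl : ∀ x ∈ l, x ≤ m) (h' : WalkDominates r' (m :: s')) :
    WalkDominates (r ++ (l ++ r')) (s ++ m :: s') := by
  refine (h.append (prepend_le hl h')).trans ?_
  simpa using stutter_left s m s'

theorem of_forall₂ {r s : List ℤ} (hr : r ≠ []) (h : List.Forall₂ (· ≤ ·) r s) :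
    WalkDominates r s := by
  induction h with
  | nil => exact absurd rfl hr
  | @cons a b r s hab h ih =>
    cases h with
    | nil => exact single hab
    | cons h₁ h₂ => exact cons hab (ih (by simp))

end WalkDominates

/-! ### Extensions and walks -/

theorem cons_mem_extensions {a : ℤ} {s e : List ℤ} :
    e ∈ extensions (a :: s) ↔
      ∃ k : ℕ, 1 ≤ k ∧ ∃ e' ∈ extensions s, e = List.replicate k a ++ e' := by
  constructor
  · rintro ⟨k, hk, hk', rfl⟩
    cases k with
    | nil => simp at hk
    | cons m k =>
      exact ⟨m, hk' m (by simp), _, ⟨k, by simpa using hk, fun x hx => hk' x (by simp [hx]), rfl⟩,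
        by simp⟩
  · rintro ⟨m, hm, _, ⟨k, hk, hk', rfl⟩, rfl⟩
    exact ⟨m :: k, by simpa using hk, by simpa using ⟨hm, hk'⟩, by simp⟩

theorem nil_mem_extensions_nil : [] ∈ extensions [] := ⟨[], by simp⟩

theorem eq_nil_of_mem_extensions_nil {e : List ℤ} (h : e ∈ extensions []) : e = [] := by
  obtain ⟨k, -, -, rfl⟩ := h
  simp

theorem cons_mem_extensions_of_mem {a : ℤ} {s e : List ℤ} (h : e ∈ extensions s) :
    a :: e ∈ extensions (a :: s) :=
  cons_mem_extensions.2 ⟨1, le_rfl, e, h, rfl⟩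

theorem cons_mem_extensions_of_mem_cons {a : ℤ} {s e : List ℤ} (h : e ∈ extensions (a :: s)) :
    a :: e ∈ extensions (a :: s) := by
  obtain ⟨k, hk, e', he', rfl⟩ := cons_mem_extensions.1 h
  exact cons_mem_extensions.2 ⟨k + 1, by omega, e', he', by simp [List.replicate_succ]⟩

theorem walkDominates_replicate_append {a : ℤ} {r s : List ℤ} {k : ℕ} (hk : 1 ≤ k)
    (h : ∀ b, b = a → WalkDominates (b :: r) (b :: s) ∧ WalkDominates (b :: s) (b :: r)) :
    WalkDominates (a :: r) (List.replicate k a ++ s) ∧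
      WalkDominates (List.replicate k a ++ s) (a :: r) := by
  induction k, hk using Nat.le_induction with
  | base => simpa using h a rfl
  | succ k hk ih =>
    obtain ⟨k, rfl⟩ : ∃ j, k = j + 1 := ⟨k - 1, by omega⟩
    simp only [List.replicate_succ, List.cons_append] at ih ⊢
    exact ⟨.right le_rfl ih.1, .left le_rfl ih.2⟩

theorem walkDominates_of_mem_extensions {s e : List ℤ} (hs : s ≠ []) (h : e ∈ extensions s) :
    WalkDominates s e ∧ WalkDominates e s := by
  induction s generalizing e with
  | nil => exact absurd rfl hs
  | cons a s ih =>
    obtain ⟨k, hk, e', he', rfl⟩ := cons_mem_extensions.1 h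
    refine walkDominates_replicate_append hk ?_
    rintro _ rfl
    cases s with
    | nil =>
      rw [eq_nil_of_mem_extensions_nil he']
      exact ⟨.single le_rfl, .single le_rfl⟩
    | cons b s =>
      obtain ⟨h₁, h₂⟩ := ih (by simp) he'
      exact ⟨.cons le_rfl h₁, .cons le_rfl h₂⟩

/-- The entries read off along the walk form the two extensions: a step repeats the entry of the
coordinate that stays. -/
theorem WalkDominates.dominates {r s : List ℤ} (h : WalkDominates r s) : Dominates r s := by
  induction h with
  | @single a b hab =>
    exact ⟨[a], cons_mem_extensions_of_mem nil_mem_extensions_nil, [b],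
      cons_mem_extensions_of_mem nil_mem_extensions_nil, .cons hab .nil⟩
  | left hab _ ih =>
    obtain ⟨r', hr', s', hs', h⟩ := ih
    exact ⟨_, cons_mem_extensions_of_mem hr', _, cons_mem_extensions_of_mem_cons hs',
      .cons hab h⟩
  | right hab _ ih =>
    obtain ⟨r', hr', s', hs', h⟩ := ih
    exact ⟨_, cons_mem_extensions_of_mem_cons hr', _, cons_mem_extensions_of_mem hs',
      .cons hab h⟩

theorem Dominates.walkDominates {r s : List ℤ} (hr : r ≠ []) (hs : s ≠ []) (h : Dominates r s) :
    WalkDominates r s := by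
  obtain ⟨r', hr', s', hs', h⟩ := h
  have h₁ := (walkDominates_of_mem_extensions hr hr').1
  exact (h₁.trans (.of_forall₂ h₁.ne_nil.2 h)).trans (walkDominates_of_mem_extensions hs hs').2

/-! ### Non-diagonal merges -/

namespace IsNonDiagonalMerge

theorem ne_nil {r s t : List ℤ} (h : IsNonDiagonalMerge r s t) : r ≠ [] ∧ s ≠ [] ∧ t ≠ [] := by
  cases h <;> simp

theorem symm {r s t : List ℤ} (h : IsNonDiagonalMerge r s t) : IsNonDiagonalMerge s r t := by
  induction h with
  | single a b => rw [add_comm]; exact single b a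
  | stepLeft a a' b r s t _ ih => rw [add_comm]; exact stepRight _ _ _ _ _ _ ih
  | stepRight a b b' r s t _ ih => rw [add_comm]; exact stepLeft _ _ _ _ _ _ ih

/-- Stating the head through `head?` allows sequences not displayed as a `cons`, such as `v ++ [c]`
or `prefixCuts`. -/
theorem cons_left {a b : ℤ} {r s t : List ℤ} (h : IsNonDiagonalMerge r s t)
    (hb : s.head? = some b) : IsNonDiagonalMerge (a :: r) s ((a + b) :: t) := by
  obtain ⟨hr, hs, -⟩ := h.ne_nil
  obtain ⟨a', r, rfl⟩ := List.exists_cons_of_ne_nil hr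
  obtain ⟨c, s, rfl⟩ := List.exists_cons_of_ne_nil hs
  cases hb
  exact stepLeft _ _ _ _ _ _ h

theorem cons_right {a b : ℤ} {r s t : List ℤ} (h : IsNonDiagonalMerge r s t)
    (ha : r.head? = some a) : IsNonDiagonalMerge r (b :: s) ((a + b) :: t) := by
  rw [add_comm]
  exact (h.symm.cons_left ha).symm

theorem append_left {b : ℤ} (l : List ℤ) {r s t : List ℤ} (h : IsNonDiagonalMerge r s t)
    (hb : s.head? = some b) : IsNonDiagonalMerge (l ++ r) s (l.map (· + b) ++ t) := by
  induction l with
  | nil => exact h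
  | cons a l ih => exact ih.cons_left hb

theorem append_right {a : ℤ} (l : List ℤ) {r s t : List ℤ} (h : IsNonDiagonalMerge r s t)
    (ha : r.head? = some a) : IsNonDiagonalMerge r (l ++ s) (l.map (a + ·) ++ t) := by
  induction l with
  | nil => exact h
  | cons b l ih => exact ih.cons_right ha

theorem concat_left {a b : ℤ} {r s t : List ℤ} (h : IsNonDiagonalMerge r s t)
    (hb : s.getLast? = some b) : IsNonDiagonalMerge (r ++ [a]) s (t ++ [a + b]) := by
  induction h with
  | single a' b' => cases hb; exact stepLeft _ _ _ _ _ _ (single _ _)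
  | stepLeft a' _ b' r s t _ ih => exact (ih hb).cons_left rfl
  | stepRight a' b' b'' r s t _ ih =>
    exact (ih (by simpa using hb)).cons_right rfl

theorem concat_right {a b : ℤ} {r s t : List ℤ} (h : IsNonDiagonalMerge r s t)
    (ha : r.getLast? = some a) : IsNonDiagonalMerge r (s ++ [b]) (t ++ [a + b]) := by
  rw [add_comm]
  exact (h.symm.concat_left ha).symm

theorem reverse {r s t : List ℤ} (h : IsNonDiagonalMerge r s t) :
    IsNonDiagonalMerge r.reverse s.reverse t.reverse := by
  induction h with
  | single a b => exact single a b
  | stepLeft a a' b r s t _ ih =>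
    rw [List.reverse_cons (a := a), List.reverse_cons (a := a + b)]
    exact ih.concat_left (by simp)
  | stepRight a b b' r s t _ ih =>
    rw [List.reverse_cons (a := b), List.reverse_cons (a := a + b)]
    exact ih.concat_right (by simp)

theorem exists_add_of_mem {r s t : List ℤ} (h : IsNonDiagonalMerge r s t) {c : ℤ} (hc : c ∈ t) :
    ∃ a ∈ r, ∃ b ∈ s, c = a + b := by
  induction h with
  | single a b => simpa using hc
  | stepLeft a a' b r s t _ ih =>
    rcases List.mem_cons.1 hc with rfl | hc
    · exact ⟨a, by simp, b, by simp, rfl⟩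
    · obtain ⟨x, hx, y, hy, h⟩ := ih hc
      exact ⟨x, List.mem_cons_of_mem _ hx, y, hy, h⟩
  | stepRight a b b' r s t _ ih =>
    rcases List.mem_cons.1 hc with rfl | hc
    · exact ⟨a, by simp, b, by simp, rfl⟩
    · obtain ⟨x, hx, y, hy, h⟩ := ih hc
      exact ⟨x, hx, y, List.mem_cons_of_mem _ hy, h⟩

theorem exists_mem_of_mem_left {r s t : List ℤ} (h : IsNonDiagonalMerge r s t) {a : ℤ}
    (ha : a ∈ r) : ∃ b ∈ s, a + b ∈ t := by
  induction h with
  | single a b => simpa using ha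
  | stepLeft a a' b r s t _ ih =>
    rcases List.mem_cons.1 ha with rfl | ha
    · exact ⟨b, by simp, by simp⟩
    · obtain ⟨y, hy, h⟩ := ih ha
      exact ⟨y, hy, List.mem_cons_of_mem _ h⟩
  | stepRight a b b' r s t _ ih =>
    obtain ⟨y, hy, h⟩ := ih ha
    exact ⟨y, List.mem_cons_of_mem _ hy, List.mem_cons_of_mem _ h⟩

theorem exists_mem_of_mem_right {r s t : List ℤ} (h : IsNonDiagonalMerge r s t) {b : ℤ}
    (hb : b ∈ s) : ∃ a ∈ r, a + b ∈ t := by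
  obtain ⟨a, ha, h⟩ := h.symm.exists_mem_of_mem_left hb
  exact ⟨a, ha, add_comm a b ▸ h⟩

/-- Restricting a merge to the rows of an initial and of the complementary final segment of its
first sequence. -/
theorem split_left {l r s t : List ℤ} (h : IsNonDiagonalMerge (l ++ r) s t) (hl : l ≠ [])
    (hr : r ≠ []) : ∃ v c w t₁ t₂, s = v ++ c :: w ∧ t = t₁ ++ t₂ ∧
      IsNonDiagonalMerge l (v ++ [c]) t₁ ∧ IsNonDiagonalMerge r (c :: w) t₂ := by
  generalize hR : l ++ r = R at h
  induction h generalizing l with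
  | single a b =>
    have := congrArg List.length hR
    have := List.length_pos_iff.2 hl
    have := List.length_pos_iff.2 hr
    simp at *
    omega
  | stepLeft a a' b r' s t h ih =>
    obtain ⟨x, l, rfl⟩ := List.exists_cons_of_ne_nil hl
    rw [List.cons_append, List.cons.injEq] at hR
    obtain ⟨rfl, hR⟩ := hR
    by_cases hl' : l = []
    · subst hl'
      rw [List.nil_append] at hR
      subst hR
      -- The path leaves the last row of the initial segment along column `b`, which therefore
      -- belongs to both parts.
      exact ⟨[], b, s, [x + b], t, rfl, rfl, single _ _, h⟩
    · obtain ⟨v, c, w, t₁, t₂, hs, rfl, h₁, h₂⟩ := ih hl' hR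
      refine ⟨v, c, w, (x + b) :: t₁, t₂, hs, rfl, h₁.cons_left ?_, h₂⟩
      cases v <;> simp_all
  | stepRight a b b' r' s t h ih =>
    obtain ⟨v, c, w, t₁, t₂, hs, rfl, h₁, h₂⟩ := ih hl hR
    refine ⟨b :: v, c, w, (a + b) :: t₁, t₂, by simp [hs], rfl, h₁.cons_right ?_, h₂⟩
    cases l <;> simp_all

theorem split_right {l r s t : List ℤ} (h : IsNonDiagonalMerge s (l ++ r) t) (hl : l ≠ [])
    (hr : r ≠ []) : ∃ v c w t₁ t₂, s = v ++ c :: w ∧ t = t₁ ++ t₂ ∧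
      IsNonDiagonalMerge (v ++ [c]) l t₁ ∧ IsNonDiagonalMerge (c :: w) r t₂ := by
  obtain ⟨v, c, w, t₁, t₂, hs, ht, h₁, h₂⟩ := h.symm.split_left hl hr
  exact ⟨v, c, w, t₁, t₂, hs, ht, h₁.symm, h₂.symm⟩

/-- A final segment of a merge is a merge of final segments. -/
theorem exists_suffix {r s l t : List ℤ} {m : ℤ} (h : IsNonDiagonalMerge r s (l ++ m :: t)) :
    ∃ r₁ r₂ s₁ s₂, r = r₁ ++ r₂ ∧ s = s₁ ++ s₂ ∧ IsNonDiagonalMerge r₂ s₂ (m :: t) := by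
  induction l generalizing r s with
  | nil => exact ⟨[], r, [], s, rfl, rfl, h⟩
  | cons c l ih =>
    generalize hq : c :: l ++ m :: t = q at h
    cases h with
    | single a b => simp at hq
    | stepLeft a a' b r s q h =>
      simp only [List.cons_append, List.cons.injEq] at hq
      obtain ⟨r₁, r₂, s₁, s₂, hr, hs, h'⟩ := ih (hq.2 ▸ h)
      exact ⟨a :: r₁, r₂, s₁, s₂, by simp [hr], hs, h'⟩
    | stepRight a b b' r s q h =>
      simp only [List.cons_append, List.cons.injEq] at hq
      obtain ⟨r₁, r₂, s₁, s₂, hr, hs, h'⟩ := ih (hq.2 ▸ h)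
      exact ⟨r₁, r₂, b :: s₁, s₂, hr, by simp [hs], h'⟩

/-- The entries `p + s j` dominate every merge of `r` and `s` if `p` is a lower bound of `r`. -/
theorem walkDominates_map {p : ℤ} {r s t : List ℤ} (h : IsNonDiagonalMerge r s t)
    (hp : ∀ a ∈ r, p ≤ a) : WalkDominates (s.map (p + ·)) t := by
  induction h with
  | single a b => exact .single (by simpa using hp)
  | stepLeft a a' b r s t h ih =>
    obtain ⟨c, t, rfl⟩ := List.exists_cons_of_ne_nil h.ne_nil.2.2
    exact .right (by simpa using hp a (by simp)) (ih fun x hx => hp x (List.mem_cons_of_mem _ hx))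
  | stepRight a b b' r s t h ih =>
    exact .cons (by simpa using hp a (by simp)) (ih hp)

theorem head_eq {a b c : ℤ} {r s t : List ℤ}
    (h : IsNonDiagonalMerge (a :: r) (b :: s) (c :: t)) : c = a + b := by
  cases h <;> rfl

/-- The walk through `r'` and `r` and the merge path through `r` and `s` are synchronized on `r`. A
step in `r'` lengthens only the new merge, a step in `r` only the old one, and a step in `s`
lengthens both. -/
theorem mono_left {r r' s t : List ℤ} (hr : WalkDominates r' r) (h : IsNonDiagonalMerge r s t) :
    ∃ t', IsNonDiagonalMerge r' s t' ∧ WalkDominates t' t := by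
  induction hr generalizing s t with
  | @single a b hab =>
    generalize hq : [b] = q at h
    induction h with
    | single b c =>
      cases hq
      exact ⟨_, single a c, .single (by linarith)⟩
    | stepLeft => cases hq
    | stepRight b c c' r s t h ih =>
      cases hq
      obtain ⟨t', h', hd⟩ := ih rfl
      exact ⟨_, h'.cons_right rfl, .cons (by linarith) hd⟩
  | @left a a' b r' r hab _ ih =>
    obtain ⟨-, hs, ht⟩ := h.ne_nil
    obtain ⟨c, s, rfl⟩ := List.exists_cons_of_ne_nil hs
    obtain ⟨d, t, rfl⟩ := List.exists_cons_of_ne_nil ht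
    obtain ⟨t', h', hd⟩ := ih h
    obtain ⟨e, t', rfl⟩ := List.exists_cons_of_ne_nil h'.ne_nil.2.2
    exact ⟨_, h'.cons_left rfl, .left (by linarith [h.head_eq]) hd⟩
  | @right a b b' r' r hab _ ih =>
    generalize hq : b :: b' :: r = q at h
    induction h with
    | single b c => cases hq
    | stepLeft b b' c r s t h _ =>
      cases hq
      obtain ⟨t', h', hd⟩ := ih h
      obtain ⟨e, t', rfl⟩ := List.exists_cons_of_ne_nil h'.ne_nil.2.2
      obtain ⟨d, t, rfl⟩ := List.exists_cons_of_ne_nil h.ne_nil.2.2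
      exact ⟨_, h', .right (by linarith [h'.head_eq]) hd⟩
    | stepRight b c c' r s t h ih' =>
      cases hq
      obtain ⟨t', h', hd⟩ := ih' rfl
      exact ⟨_, h'.cons_right rfl, .cons (by linarith) hd⟩

theorem mono {r r' s s' t : List ℤ} (hr : WalkDominates r' r) (hs : WalkDominates s' s)
    (h : IsNonDiagonalMerge r s t) :
    ∃ t', IsNonDiagonalMerge r' s' t' ∧ WalkDominates t' t := by
  obtain ⟨t₁, h₁, hd₁⟩ := h.mono_left hr
  obtain ⟨t₂, h₂, hd₂⟩ := h₁.symm.mono_left hs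
  exact ⟨t₂, h₂.symm, hd₂.trans hd₁⟩

end IsNonDiagonalMerge

/-! ### Existence of a dominating merge -/

theorem exists_eq_append_max {l : List ℤ} (hl : l ≠ []) :
    ∃ u m w, l = u ++ m :: w ∧ ∀ b ∈ l, b ≤ m := by
  obtain ⟨m, hm, h⟩ := l.toFinset.exists_max_image id (by simpa using hl)
  obtain ⟨u, w, rfl⟩ := List.append_of_mem (List.mem_toFinset.1 hm)
  exact ⟨u, m, w, rfl, fun b hb => h b (List.mem_toFinset.2 hb)⟩

/-- Splitting a sequence at the first later entry that is at most its head. -/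
theorem exists_eq_append_descent {x : ℤ} {r : List ℤ} (h : ∃ y ∈ r, y ≤ x) :
    ∃ l p r', r = l ++ p :: r' ∧ p ≤ x ∧ ∀ a ∈ l, x ≤ a := by
  induction r with
  | nil => simp at h
  | cons b r ih =>
    by_cases hb : b ≤ x
    · exact ⟨[], b, r, rfl, hb, by simp⟩
    · obtain ⟨y, hy, hyx⟩ := h
      have hy : y ∈ r := (List.mem_cons.1 hy).resolve_left (by rintro rfl; exact hb hyx)
      obtain ⟨l, p, r', rfl, hp, hl⟩ := ih ⟨y, hy, hyx⟩
      exact ⟨b :: l, p, r', rfl, hp, by simpa using ⟨(not_le.1 hb).le, hl⟩⟩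

/-- The segment `l` stays between its head and above `p`, and its rise above its head is at most
the rise that `s` needs before it can fall below its head. -/
def IsCheapDescent (l : List ℤ) (p : ℤ) (s : List ℤ) : Prop :=
  ∃ x z, l.head? = some x ∧ s.head? = some z ∧ (∀ a ∈ l, p ≤ a ∧ x ≤ a) ∧
    ((∀ b ∈ s, z ≤ b) ∨
      ∃ u h w, s = u ++ h :: w ∧ (∀ b ∈ u, z ≤ b ∧ b ≤ h) ∧ ∀ a ∈ l, a + z ≤ x + h)

/-- There is a non-diagonal merge of `r` and `s` that dominates all of them. -/
def HasDominatingMerge (r s : List ℤ) : Prop :=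
  ∃ t, IsNonDiagonalMerge r s t ∧ ∀ t', IsNonDiagonalMerge r s t' → WalkDominates t t'

namespace IsNonDiagonalMerge

/-- The dominating sequence follows column `z` and then row `p`. It waits at `x + z` until the other
merge reaches the pivot `m`, goes at `m` through the rest of the column and through `va`, and
finally uses that row `p` is the cheapest for `vb`. -/
theorem walkDominates_of_pivot {x z p m : ℤ} {l q₁ q₂ rb va vb : List ℤ}
    (hx : ∀ c ∈ q₁ ++ [m], x + z ≤ c) (hl : ∀ a ∈ l, a + z ≤ m) (hv : ∀ b ∈ va, p + b ≤ m)
    (h : IsNonDiagonalMerge rb vb (m :: q₂)) (hp : ∀ a ∈ rb, p ≤ a) :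
    WalkDominates ((x :: l).map (· + z) ++ (va ++ vb).map (p + ·)) (q₁ ++ m :: q₂) := by
  have h₁ := WalkDominates.single_of_forall_le (by simp) hx
  have := h₁.join (l := l.map (· + z) ++ va.map (p + ·)) ?_ (h.walkDominates_map hp)
  · simpa using this
  · intro c hc
    rcases List.mem_append.1 hc with hc | hc
    · obtain ⟨a, ha, rfl⟩ := List.mem_map.1 hc
      exact hl a ha
    · obtain ⟨b, hb, rfl⟩ := List.mem_map.1 hc
      exact hv b hb

/-- The pivot is a maximal entry of the merge. The merge visits every row and every column, so this
entry is at least `a + z` for each row `a` and at least `p + b` for each column `b`. -/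
theorem walkDominates_of_forall_le {x z p : ℤ} {l v t : List ℤ}
    (h : IsNonDiagonalMerge (x :: l) v t) (hl : ∀ a ∈ x :: l, p ≤ a ∧ x ≤ a)
    (hv : ∀ b ∈ v, z ≤ b) :
    WalkDominates ((x :: l).map (· + z) ++ v.map (p + ·)) t := by
  obtain ⟨q₁, m, q₂, rfl, hm⟩ := exists_eq_append_max h.ne_nil.2.2
  obtain ⟨r₁, r₂, s₁, s₂, hr, rfl, h'⟩ := h.exists_suffix
  refine walkDominates_of_pivot ?_ ?_ ?_ h' ?_
  · intro c hc
    obtain ⟨a, ha, b, hb, rfl⟩ := h.exists_add_of_mem (c := c) (by simp at hc ⊢; tauto)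
    linarith [(hl a ha).2, hv b hb]
  · intro a ha
    obtain ⟨b, hb, hab⟩ := h.exists_mem_of_mem_left (List.mem_cons_of_mem x ha)
    linarith [hv b hb, hm _ hab]
  · intro b hb
    obtain ⟨a, ha, hab⟩ := h.exists_mem_of_mem_right (List.mem_append_left s₂ hb)
    linarith [(hl a ha).1, hm _ hab]
  · intro a ha
    exact (hl a (hr ▸ List.mem_append_right _ ha)).1

/-- The entry `y + h` is where the path first enters column `h`; it serves as the pivot below. -/
theorem exists_at_column {r u w t : List ℤ} {h : ℤ}
    (hm : IsNonDiagonalMerge r (u ++ h :: w) t) : ∃ q₁ y q₂ r₁ r₂,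
      r = r₁ ++ y :: r₂ ∧ t = q₁ ++ (y + h) :: q₂ ∧
      IsNonDiagonalMerge (y :: r₂) (h :: w) ((y + h) :: q₂) ∧
      ∀ c ∈ q₁, ∃ a ∈ r, ∃ b ∈ u, c = a + b := by
  by_cases hu : u = []
  · subst hu
    obtain ⟨hr, -, ht⟩ := hm.ne_nil
    obtain ⟨a, r, rfl⟩ := List.exists_cons_of_ne_nil hr
    obtain ⟨d, t, rfl⟩ := List.exists_cons_of_ne_nil ht
    obtain rfl := head_eq hm
    exact ⟨[], a, t, [], r, rfl, rfl, hm, by simp⟩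
  · obtain ⟨v, c, r₂, t₁, t₂, rfl, rfl, h₁, h₂⟩ := hm.split_right hu (by simp)
    obtain ⟨d, t₂, rfl⟩ := List.exists_cons_of_ne_nil h₂.ne_nil.2.2
    obtain rfl := head_eq h₂
    refine ⟨t₁, c, t₂, v, r₂, rfl, rfl, h₂, fun e he => ?_⟩
    obtain ⟨a, ha, b, hb, rfl⟩ := h₁.exists_add_of_mem he
    exact ⟨a, by simp at ha ⊢; tauto, b, hb, rfl⟩

/-- The pivot is `y + h`. It bounds the whole descent in column `z`, since `a + z ≤ x + h ≤ y + h`,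
and the part of row `p` before column `h`. -/
theorem walkDominates_of_hill {x z p h : ℤ} {l u w t : List ℤ}
    (hm : IsNonDiagonalMerge (x :: l) (u ++ h :: w) t) (hl : ∀ a ∈ x :: l, p ≤ a ∧ x ≤ a)
    (hu : ∀ b ∈ u, z ≤ b ∧ b ≤ h) (hh : ∀ a ∈ x :: l, a + z ≤ x + h) :
    WalkDominates ((x :: l).map (· + z) ++ (u ++ h :: w).map (p + ·)) t := by
  obtain ⟨q₁, y, q₂, r₁, r₂, hr, rfl, h', hq⟩ := hm.exists_at_column
  have hy : y ∈ x :: l := by simp [hr]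
  have hz := hh x (by simp)
  refine walkDominates_of_pivot ?_ ?_ ?_ h' ?_
  · intro c hc
    rcases List.mem_append.1 hc with hc | hc
    · obtain ⟨a, ha, b, hb, rfl⟩ := hq c hc
      linarith [(hl a ha).2, (hu b hb).1]
    · rw [List.mem_singleton.1 hc]
      linarith [(hl y hy).2]
  · intro a ha
    linarith [hh a (List.mem_cons_of_mem x ha), (hl y hy).2]
  · intro b hb
    linarith [(hl y hy).1, (hu b hb).2]
  · intro a ha
    exact (hl a (hr ▸ List.mem_append_right _ ha)).1

/-- A merge is dominated by one that starts with a cheap descent. -/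
theorem exists_walkDominates_of_isCheapDescent {p : ℤ} {l r s t : List ℤ}
    (h : IsNonDiagonalMerge (l ++ p :: r) s t) (hd : IsCheapDescent l p s) :
    ∃ z t', s.head? = some z ∧ IsNonDiagonalMerge (p :: r) s t' ∧
      WalkDominates (l.map (· + z) ++ t') t := by
  obtain ⟨x, z, hx, hz, hl, hs⟩ := hd
  obtain ⟨l, rfl⟩ : ∃ l', l = x :: l' := by cases l <;> simp_all
  obtain ⟨v, c, w, t₁, t₂, rfl, rfl, h₁, h₂⟩ := h.split_left (by simp) (by simp)
  obtain ⟨d, t₂, rfl⟩ := List.exists_cons_of_ne_nil h₂.ne_nil.2.2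
  obtain rfl := head_eq h₂
  -- The new merge descends in column `z`, crosses row `p` up to column `c`, where the old path
  -- enters this row, and then follows the old path.
  refine ⟨z, _, hz, h₂.append_right v rfl, ?_⟩
  suffices hw : WalkDominates ((x :: l).map (· + z) ++ (v ++ [c]).map (p + ·)) t₁ by
    have hw := hw.append (WalkDominates.refl (List.cons_ne_nil (p + c) t₂))
    refine WalkDominates.trans ?_ hw
    simpa using WalkDominates.stutter_right ((x :: l).map (· + z) ++ v.map (p + ·)) (p + c) t₂
  -- The hill `k` matters only if the path reaches its column before leaving the descent; otherwise
  -- all columns visited are at least `z`.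
  rcases hs with hs | ⟨u, k, w', hs, hu, hk⟩
  · exact h₁.walkDominates_of_forall_le hl fun b hb => hs b (by simp at hb ⊢; tauto)
  · have hs' : v ++ [c] ++ w = u ++ k :: w' := by simpa using hs
    rcases List.append_eq_append_iff.1 hs' with ⟨e, he, -⟩ | ⟨e, he, he'⟩
    · exact h₁.walkDominates_of_forall_le hl fun b hb => (hu b (he ▸ List.mem_append_left _ hb)).1
    · cases e with
      | nil =>
        refine h₁.walkDominates_of_forall_le hl fun b hb => (hu b ?_).1
        simpa [he] using hb
      | cons k' e =>
        obtain ⟨rfl, -⟩ := List.cons.inj he'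
        rw [he] at h₁ ⊢
        exact h₁.walkDominates_of_hill hl hu hk

end IsNonDiagonalMerge

namespace HasDominatingMerge

theorem symm {r s : List ℤ} (h : HasDominatingMerge r s) : HasDominatingMerge s r := by
  obtain ⟨t, ht, h⟩ := h
  exact ⟨t, ht.symm, fun t' ht' => h t' ht'.symm⟩

theorem reverse {r s : List ℤ} (h : HasDominatingMerge r s) :
    HasDominatingMerge r.reverse s.reverse := by
  obtain ⟨t, ht, h⟩ := h
  refine ⟨t.reverse, ht.reverse, fun t' ht' => ?_⟩
  have := (h t'.reverse (by simpa using ht'.reverse)).reverse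
  simpa using this

theorem of_isCheapDescent {p : ℤ} {l r s : List ℤ} (hd : IsCheapDescent l p s)
    (h : HasDominatingMerge (p :: r) s) : HasDominatingMerge (l ++ p :: r) s := by
  obtain ⟨t, ht, h⟩ := h
  have hz : ∃ z, s.head? = some z := by
    obtain ⟨x, z, -, hz, -⟩ := hd
    exact ⟨z, hz⟩
  obtain ⟨z, hz⟩ := hz
  refine ⟨l.map (· + z) ++ t, ht.append_left l hz, fun q hq => ?_⟩
  obtain ⟨z', t', hz', ht', hw⟩ := hq.exists_walkDominates_of_isCheapDescent hd
  obtain rfl : z = z' := Option.some.inj (hz.symm.trans hz')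
  exact (WalkDominates.prepend _ (h t' ht')).trans hw

end HasDominatingMerge

theorem isCheapDescent_of_forall_le {x z p : ℤ} {l s : List ℤ} (hp : p ≤ x)
    (hl : ∀ a ∈ l, x ≤ a) (hs : ∀ b ∈ s, z ≤ b) : IsCheapDescent (x :: l) p (z :: s) :=
  ⟨x, z, rfl, rfl, by simpa using ⟨hp, fun a ha => ⟨hp.trans (hl a ha), hl a ha⟩⟩,
    .inl (by simpa using hs)⟩

/-- Of the two initial descents, the one with the smaller rise is cheap. -/
theorem isCheapDescent_or {x z p q : ℤ} {l r l' s : List ℤ} (hp : p ≤ x) (hq : q ≤ z)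
    (hl : ∀ a ∈ l, x ≤ a) (hl' : ∀ b ∈ l', z ≤ b) :
    IsCheapDescent (x :: l) p (z :: (l' ++ q :: s)) ∨
      IsCheapDescent (z :: l') q (x :: (l ++ p :: r)) := by
  have aux : ∀ {x z p m k : ℤ} {l l' s u w : List ℤ}, p ≤ x → (∀ a ∈ l, x ≤ a) →
      (∀ b ∈ l', z ≤ b) → (∀ a ∈ x :: l, a ≤ m) → z :: l' = u ++ k :: w →
      (∀ b ∈ z :: l', b ≤ k) → m + z ≤ x + k → IsCheapDescent (x :: l) p (z :: (l' ++ s)) := by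
    intro x z p m k l l' s u w hp hl hl' hm huw hk hmk
    refine ⟨x, z, rfl, rfl, by simpa using ⟨hp, fun a ha => ⟨hp.trans (hl a ha), hl a ha⟩⟩,
      .inr ⟨u, k, w ++ s, ?_, fun b hb => ?_, fun a ha => by linarith [hm a ha]⟩⟩
    · rw [← List.cons_append, huw]
      simp
    · have hb' : b ∈ z :: l' := by simp [huw, hb]
      refine ⟨?_, hk b hb'⟩
      rcases List.mem_cons.1 hb' with rfl | hb'
      exacts [le_rfl, hl' b hb']
  -- The rises `m - x` and `k - z` are compared; the peak of the higher descent is the hill for the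
  -- other one.
  obtain ⟨u, m, w, hu, hm⟩ := exists_eq_append_max (List.cons_ne_nil x l)
  obtain ⟨u', k, w', hu', hk⟩ := exists_eq_append_max (List.cons_ne_nil z l')
  rcases le_total (m + z) (x + k) with h | h
  · exact .inl (aux hp hl hl' hm hu' hk h)
  · exact .inr (aux hq hl' hl hk hu hm (by linarith))

/-- The induction step for sequences one of which returns to the level of its head. -/
theorem HasDominatingMerge.of_descent {x z : ℤ} {r s : List ℤ}
    (ih : ∀ r' s' : List ℤ, r' ≠ [] → s' ≠ [] →
      r'.length + s'.length < (x :: r).length + (z :: s).length → HasDominatingMerge r' s')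
    (h : (∃ y ∈ r, y ≤ x) ∨ ∃ y ∈ s, y ≤ z) : HasDominatingMerge (x :: r) (z :: s) := by
  by_cases hr : ∃ y ∈ r, y ≤ x <;> by_cases hs : ∃ y ∈ s, y ≤ z
  · obtain ⟨l, p, r, rfl, hp, hl⟩ := exists_eq_append_descent hr
    obtain ⟨l', q, s, rfl, hq, hl'⟩ := exists_eq_append_descent hs
    rcases isCheapDescent_or (r := r) (s := s) hp hq hl hl' with hd | hd
    · exact of_isCheapDescent hd (ih _ _ (by simp) (by simp) (by simp))
    · exact (of_isCheapDescent hd (ih _ _ (by simp) (by simp) (by simp; omega))).symm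
  · obtain ⟨l, p, r, rfl, hp, hl⟩ := exists_eq_append_descent hr
    push Not at hs
    exact of_isCheapDescent (isCheapDescent_of_forall_le hp hl fun b hb => (hs b hb).le)
      (ih _ _ (by simp) (by simp) (by simp))
  · obtain ⟨l, q, s, rfl, hq, hl⟩ := exists_eq_append_descent hs
    push Not at hr
    exact (of_isCheapDescent (isCheapDescent_of_forall_le hq hl fun b hb => (hr b hb).le)
      (ih _ _ (by simp) (by simp) (by simp; omega))).symm
  · exact absurd h (not_or.2 ⟨hr, hs⟩)

/-- A sequence that stays above its head ends, when reversed, with its smallest entry and so returns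
to its level. -/
theorem exists_le_of_reverse {x y : ℤ} {r r' : List ℤ} (h : (x :: r).reverse = y :: r')
    (hr : ∀ b ∈ r, x < b) (hne : r ≠ []) : ∃ b ∈ r', b ≤ y := by
  have h' : x :: r = r'.reverse ++ [y] := by simpa using congrArg List.reverse h
  have hne' : r'.reverse ≠ [] := by
    intro h₀
    rw [h₀] at h'
    simp at h'
    exact hne h'.2
  obtain ⟨b, q, hq⟩ := List.exists_cons_of_ne_nil hne'
  rw [hq, List.cons_append, List.cons.injEq] at h'
  refine ⟨x, ?_, (hr y (by simp [h'.2])).le⟩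
  rw [← List.mem_reverse, hq, h'.1]
  simp

/-- Among the non-diagonal merges of two sequences there is one that dominates all the others. -/
theorem hasDominatingMerge {r s : List ℤ} (hr : r ≠ []) (hs : s ≠ []) :
    HasDominatingMerge r s := by
  induction hn : r.length + s.length using Nat.strong_induction_on generalizing r s with
  | _ n ih =>
    have ih' : ∀ r' s' : List ℤ, r' ≠ [] → s' ≠ [] → r'.length + s'.length < r.length + s.length →
        HasDominatingMerge r' s' := fun r' s' hr' hs' h => ih _ (hn ▸ h) hr' hs' rfl
    clear ih hn
    obtain ⟨x, r, rfl⟩ := List.exists_cons_of_ne_nil hr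
    obtain ⟨z, s, rfl⟩ := List.exists_cons_of_ne_nil hs
    by_cases h : (∃ y ∈ r, y ≤ x) ∨ ∃ y ∈ s, y ≤ z
    · exact .of_descent ih' h
    push Not at h
    obtain ⟨x', r', hr'⟩ := List.exists_cons_of_ne_nil (mt List.reverse_eq_nil_iff.1 hr)
    obtain ⟨z', s', hs'⟩ := List.exists_cons_of_ne_nil (mt List.reverse_eq_nil_iff.1 hs)
    by_cases h₀ : r = [] ∧ s = []
    · obtain ⟨rfl, rfl⟩ := h₀
      refine ⟨_, .single x z, fun t' ht' => ?_⟩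
      cases ht'
      exact .single le_rfl
    have h' : (∃ y ∈ r', y ≤ x') ∨ ∃ y ∈ s', y ≤ z' := by
      by_cases hr₀ : r = []
      · exact .inr (exists_le_of_reverse hs' h.2 fun hs₀ => h₀ ⟨hr₀, hs₀⟩)
      · exact .inl (exists_le_of_reverse hr' h.1 hr₀)
    have := HasDominatingMerge.of_descent (x := x') (z := z') (r := r') (s := s') ?_ h'
    · simpa [← hr', ← hs'] using this.reverse
    · rw [← hr', ← hs', List.length_reverse, List.length_reverse]
      exact ih'

/-! ### Cut sizes along topological orders -/

namespace TerminalDigraph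

variable {V V₁ V₂ : Type u}

open Classical in
/-- The number of arcs that leave the vertex set `P`. -/
noncomputable def cutSize (G : TerminalDigraph V) (P : Set V) : ℤ :=
  ((G.arcs.countP fun a => a.1 ∈ P ∧ a.2 ∉ P : ℕ) : ℤ)

/-- The sizes of the cuts at `P` and at its successive enlargements by the vertices of a list. -/
noncomputable def prefixCuts (G : TerminalDigraph V) : Set V → List V → List ℤ
  | P, [] => [G.cutSize P]
  | P, v :: l => G.cutSize P :: prefixCuts G (insert v P) l

theorem prefixCuts_ne_nil (G : TerminalDigraph V) (P : Set V) (l : List V) :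
    G.prefixCuts P l ≠ [] := by
  cases l <;> simp [prefixCuts]

theorem head?_prefixCuts (G : TerminalDigraph V) (P : Set V) (l : List V) :
    (G.prefixCuts P l).head? = some (G.cutSize P) := by
  cases l <;> simp [prefixCuts]

theorem prefixCuts_append_cons (G : TerminalDigraph V) (P : Set V) (l : List V) (v : V)
    (l' : List V) : G.prefixCuts P (l ++ v :: l') =
      G.prefixCuts P l ++ G.prefixCuts (insert v (P ∪ {w | w ∈ l})) l' := by
  induction l generalizing P with
  | nil => simp [prefixCuts]
  | cons u l ih =>
    simp only [List.cons_append, prefixCuts, ih]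
    congr 3
    ext w
    simp
    tauto

theorem prefixCuts_eq_map_range (G : TerminalDigraph V) (P : Set V) (l : List V) :
    G.prefixCuts P l =
      (List.range (l.length + 1)).map fun i => G.cutSize (P ∪ {w | w ∈ l.take i}) := by
  induction l generalizing P with
  | nil => simp [prefixCuts]
  | cons u l ih =>
    rw [prefixCuts, ih, List.length_cons, List.range_succ_eq_map (n := l.length + 1)]
    simp only [List.map_cons, List.take_zero, List.not_mem_nil, Set.ofPred_false, Set.union_empty,
      List.map_map]
    congr 2
    funext i
    simp only [Function.comp, Nat.succ_eq_add_one, List.take_succ_cons]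
    congr 1
    ext w
    simp
    tauto

-- The sublist form passes through `map`, `filter` and `reverse`. Membership of `v` excludes the
-- value `τ.length` that `idxOf` gives to absent entries.
open Classical in
theorem idxOf_lt_idxOf_iff_sublist {τ : List V} (hτ : τ.Nodup) {u v : V} (hv : v ∈ τ) :
    τ.idxOf u < τ.idxOf v ↔ [u, v].Sublist τ := by
  induction τ with
  | nil => simp at hv
  | cons w τ ih =>
    obtain ⟨hw, hτ⟩ := List.nodup_cons.1 hτ
    by_cases hwv : w = v
    · subst hwv
      simp only [List.idxOf_cons_self, Nat.not_lt_zero, false_iff]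
      intro h
      rcases List.sublist_cons_iff.1 h with h | ⟨r, hr, h⟩
      · exact hw (h.subset (by simp))
      · cases hr
        exact hw (h.subset (by simp))
    · have hv' : v ∈ τ := (List.mem_cons.1 hv).resolve_left (Ne.symm hwv)
      rw [List.idxOf_cons_ne _ hwv]
      by_cases hwu : w = u
      · subst hwu
        simp [hv']
      · rw [List.idxOf_cons_ne _ hwu, Nat.succ_lt_succ_iff, ih hτ hv']
        refine ⟨fun h => h.cons _, fun h => ?_⟩
        rcases List.sublist_cons_iff.1 h with h | ⟨r, hr, h⟩
        · exact h
        · cases hr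
          exact absurd rfl hwu

theorem isTopologicalOrder_iff {G : TerminalDigraph V} {τ : List V} :
    G.IsTopologicalOrder τ ↔
      τ.Nodup ∧ (∀ v : V, v ∈ τ) ∧ ∀ a ∈ G.arcs, [a.1, a.2].Sublist τ := by
  refine and_congr_right fun h => and_congr_right fun h' => ?_
  exact forall₂_congr fun a _ => idxOf_lt_idxOf_iff_sublist h (h' a.2)

open Classical in
theorem cutSize_eq_countP_idxOf (G : TerminalDigraph V) {P : Set V} {τ : List V} {i : ℕ}
    (h : ∀ v, v ∈ P ↔ τ.idxOf v < i + 1) :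
    G.cutSize P = ((G.arcs.countP fun a => τ.idxOf a.1 ≤ i ∧ i < τ.idxOf a.2 : ℕ) : ℤ) := by
  rw [cutSize]
  congr 1
  refine Multiset.countP_congr rfl fun a _ => ?_
  rw [h, h]
  simp only [eq_iff_iff]
  omega

-- Cuts are taken only at nonempty proper prefixes, so they begin at `{s}` and stop before `t` is
-- added.
open Classical in
theorem cutSizeSeq_eq_prefixCuts {G : TerminalDigraph V} {s t : V} {l : List V}
    (h : G.IsTopologicalOrder (s :: (l ++ [t]))) :
    G.cutSizeSeq (s :: (l ++ [t])) = G.prefixCuts {s} l := by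
  rw [prefixCuts_eq_map_range, cutSizeSeq]
  simp only [List.length_cons, List.length_append, List.length_nil, zero_add,
    Nat.add_sub_cancel]
  refine List.map_congr_left fun i hi => (cutSize_eq_countP_idxOf G fun v => ?_).symm
  have hi : i ≤ l.length := by simpa [Nat.lt_succ_iff] using hi
  rw [← List.mem_take_iff_idxOf_lt (h.2.1 v), List.take_succ_cons, List.take_append_of_le_length hi]
  simp

/-! ### Terminals of series parallel digraphs -/

theorem IsSPD.source_ne_sink {G : TerminalDigraph V} (h : G.IsSPD) : G.source ≠ G.sink := by
  induction h with
  | arc G h => exact h.1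
  | series G₁ G₂ G f₁ f₂ _ _ h ih₁ _ =>
    rw [h.source_eq, h.sink_eq]
    exact fun h' => ih₁ ((h.identified_iff _ _).1 h').1
  | parallel G₁ G₂ G f₁ f₂ _ _ h ih₁ _ =>
    rw [h.source_eq, h.sink_eq]
    exact fun h' => ih₁ (h.injective_left h')

theorem IsSeriesComp.arc_left {G₁ : TerminalDigraph V₁} {G₂ : TerminalDigraph V₂}
    {G : TerminalDigraph V} {f₁ : V₁ → V} {f₂ : V₂ → V} (h : IsSeriesComp G₁ G₂ G f₁ f₂)
    {a : V₁ × V₁} (ha : a ∈ G₁.arcs) : Prod.map f₁ f₁ a ∈ G.arcs := by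
  rw [h.arcs_eq]
  exact Multiset.mem_add.2 (.inl (Multiset.mem_map_of_mem _ ha))

theorem IsSeriesComp.arc_right {G₁ : TerminalDigraph V₁} {G₂ : TerminalDigraph V₂}
    {G : TerminalDigraph V} {f₁ : V₁ → V} {f₂ : V₂ → V} (h : IsSeriesComp G₁ G₂ G f₁ f₂)
    {a : V₂ × V₂} (ha : a ∈ G₂.arcs) : Prod.map f₂ f₂ a ∈ G.arcs := by
  rw [h.arcs_eq]
  exact Multiset.mem_add.2 (.inr (Multiset.mem_map_of_mem _ ha))

theorem IsParallelComp.arc_left {G₁ : TerminalDigraph V₁} {G₂ : TerminalDigraph V₂}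
    {G : TerminalDigraph V} {f₁ : V₁ → V} {f₂ : V₂ → V} (h : IsParallelComp G₁ G₂ G f₁ f₂)
    {a : V₁ × V₁} (ha : a ∈ G₁.arcs) : Prod.map f₁ f₁ a ∈ G.arcs := by
  rw [h.arcs_eq]
  exact Multiset.mem_add.2 (.inl (Multiset.mem_map_of_mem _ ha))

theorem IsParallelComp.arc_right {G₁ : TerminalDigraph V₁} {G₂ : TerminalDigraph V₂}
    {G : TerminalDigraph V} {f₁ : V₁ → V} {f₂ : V₂ → V} (h : IsParallelComp G₁ G₂ G f₁ f₂)
    {a : V₂ × V₂} (ha : a ∈ G₂.arcs) : Prod.map f₂ f₂ a ∈ G.arcs := by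
  rw [h.arcs_eq]
  exact Multiset.mem_add.2 (.inr (Multiset.mem_map_of_mem _ ha))

theorem IsParallelComp.source_eq_right {G₁ : TerminalDigraph V₁} {G₂ : TerminalDigraph V₂}
    {G : TerminalDigraph V} {f₁ : V₁ → V} {f₂ : V₂ → V} (h : IsParallelComp G₁ G₂ G f₁ f₂) :
    G.source = f₂ G₂.source :=
  h.source_eq.trans ((h.identified_iff _ _).2 (.inl ⟨rfl, rfl⟩))

theorem IsParallelComp.sink_eq_right {G₁ : TerminalDigraph V₁} {G₂ : TerminalDigraph V₂}
    {G : TerminalDigraph V} {f₁ : V₁ → V} {f₂ : V₂ → V} (h : IsParallelComp G₁ G₂ G f₁ f₂) :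
    G.sink = f₂ G₂.sink :=
  h.sink_eq.trans ((h.identified_iff _ _).2 (.inr ⟨rfl, rfl⟩))

/-- This forces the source to be first in every topological order; `exists_arc_from` does the same
for the sink at the end. -/
theorem IsSPD.exists_arc_into {G : TerminalDigraph V} (h : G.IsSPD) {v : V} (hv : v ≠ G.source) :
    ∃ a ∈ G.arcs, a.2 = v := by
  induction h with
  | arc G h => exact ⟨(G.source, G.sink), by simp [h.2.2], ((h.2.1 v).resolve_left hv).symm⟩
  | series G₁ G₂ G f₁ f₂ _ _ h ih₁ ih₂ =>
    have left : ∀ x, f₁ x ≠ G.source → ∃ a ∈ G.arcs, a.2 = f₁ x := by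
      intro x hx
      obtain ⟨a, ha, rfl⟩ := ih₁ (v := x) (by rintro rfl; exact hx h.source_eq.symm)
      exact ⟨_, h.arc_left ha, rfl⟩
    rcases h.covers v with ⟨x, rfl⟩ | ⟨y, rfl⟩
    · exact left x hv
    · by_cases hy : y = G₂.source
      · have := (h.identified_iff G₁.sink y).2 ⟨rfl, hy⟩
        rw [← this] at hv ⊢
        exact left _ hv
      · obtain ⟨a, ha, rfl⟩ := ih₂ hy
        exact ⟨_, h.arc_right ha, rfl⟩
  | parallel G₁ G₂ G f₁ f₂ _ _ h ih₁ ih₂ =>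
    rcases h.covers v with ⟨x, rfl⟩ | ⟨y, rfl⟩
    · obtain ⟨a, ha, rfl⟩ := ih₁ (v := x) (by rintro rfl; exact hv h.source_eq.symm)
      exact ⟨_, h.arc_left ha, rfl⟩
    · obtain ⟨a, ha, rfl⟩ := ih₂ (v := y) (by rintro rfl; exact hv h.source_eq_right.symm)
      exact ⟨_, h.arc_right ha, rfl⟩

theorem IsSPD.exists_arc_from {G : TerminalDigraph V} (h : G.IsSPD) {v : V} (hv : v ≠ G.sink) :
    ∃ a ∈ G.arcs, a.1 = v := by
  induction h with
  | arc G h => exact ⟨(G.source, G.sink), by simp [h.2.2], ((h.2.1 v).resolve_right hv).symm⟩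
  | series G₁ G₂ G f₁ f₂ _ _ h ih₁ ih₂ =>
    have right : ∀ y, f₂ y ≠ G.sink → ∃ a ∈ G.arcs, a.1 = f₂ y := by
      intro y hy
      obtain ⟨a, ha, rfl⟩ := ih₂ (v := y) (by rintro rfl; exact hy h.sink_eq.symm)
      exact ⟨_, h.arc_right ha, rfl⟩
    rcases h.covers v with ⟨x, rfl⟩ | ⟨y, rfl⟩
    · by_cases hx : x = G₁.sink
      · have := (h.identified_iff x G₂.source).2 ⟨hx, rfl⟩
        rw [this] at hv ⊢
        exact right _ hv
      · obtain ⟨a, ha, rfl⟩ := ih₁ hx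
        exact ⟨_, h.arc_left ha, rfl⟩
    · exact right y hv
  | parallel G₁ G₂ G f₁ f₂ _ _ h ih₁ ih₂ =>
    rcases h.covers v with ⟨x, rfl⟩ | ⟨y, rfl⟩
    · obtain ⟨a, ha, rfl⟩ := ih₁ (v := x) (by rintro rfl; exact hv h.sink_eq.symm)
      exact ⟨_, h.arc_left ha, rfl⟩
    · obtain ⟨a, ha, rfl⟩ := ih₂ (v := y) (by rintro rfl; exact hv h.sink_eq_right.symm)
      exact ⟨_, h.arc_right ha, rfl⟩

/-- A topological order of a series parallel digraph starts at the source and ends at the sink. -/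
theorem IsSPD.exists_eq_cons_append {G : TerminalDigraph V} (h : G.IsSPD) {τ : List V}
    (hτ : G.IsTopologicalOrder τ) : ∃ l, τ = G.source :: (l ++ [G.sink]) := by
  classical
  obtain ⟨hnd, hmem, harc⟩ := isTopologicalOrder_iff.1 hτ
  obtain ⟨v, τ, rfl⟩ := List.exists_cons_of_ne_nil (List.ne_nil_of_mem (hmem G.source))
  have hv : v = G.source := by
    by_contra hv
    obtain ⟨a, ha, rfl⟩ := h.exists_arc_into hv
    have := hτ.2.2 a ha
    simp at this
  subst hv
  have hne : τ ≠ [] := by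
    rintro rfl
    exact h.source_ne_sink (by simpa [eq_comm] using hmem G.sink)
  obtain ⟨l, w, rfl⟩ : ∃ l w, τ = l ++ [w] :=
    ⟨τ.dropLast, τ.getLast hne, (List.dropLast_append_getLast hne).symm⟩
  refine ⟨l, ?_⟩
  by_cases hw : w = G.sink
  · rw [hw]
  obtain ⟨a, ha, rfl⟩ := h.exists_arc_from hw
  have h₁ := (harc a ha).reverse
  have h₂ := List.nodup_reverse.2 hnd
  simp only [List.reverse_cons, List.reverse_append, List.reverse_nil, List.nil_append,
    List.cons_append] at h₁ h₂
  obtain ⟨h₂, -⟩ := List.nodup_cons.1 h₂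
  rcases List.sublist_cons_iff.1 h₁ with h₁ | ⟨r, hr, h₁⟩
  · exact absurd (h₁.subset (by simp)) h₂
  · obtain ⟨-, rfl⟩ := List.cons.inj hr
    exact absurd (h₁.subset (by simp)) h₂

open Classical in
/-- Restriction of a topological order to an embedded subdigraph. -/
theorem IsTopologicalOrder.exists_restrict {G : TerminalDigraph V} {G₁ : TerminalDigraph V₁}
    {f : V₁ → V} (hf : Function.Injective f)
    (harcs : ∀ a ∈ G₁.arcs, Prod.map f f a ∈ G.arcs) {τ : List V}
    (hτ : G.IsTopologicalOrder τ) :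
    ∃ τ₁, G₁.IsTopologicalOrder τ₁ ∧ τ₁.map f = τ.filter (· ∈ Set.range f) := by
  obtain ⟨hnd, hmem, harc⟩ := isTopologicalOrder_iff.1 hτ
  obtain ⟨τ₁, h₁⟩ : τ.filter (· ∈ Set.range f) ∈ Set.range (List.map f) := by
    rw [Set.range_list_map]
    intro x hx
    simpa using (List.mem_filter.1 hx).2
  refine ⟨τ₁, isTopologicalOrder_iff.2 ⟨?_, fun x => ?_, fun a ha => ?_⟩, h₁⟩
  · exact List.Nodup.of_map f (h₁ ▸ hnd.filter _)
  · rw [← List.mem_map_of_injective hf, h₁]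
    simp [hmem]
  · have := (harc _ (harcs a ha)).filter (fun v => decide (v ∈ Set.range f))
    rw [← h₁] at this
    obtain ⟨l, hl, hl'⟩ := List.sublist_map_iff.1 this
    have hl'' : [a.1, a.2].map f = l.map f := by simpa using hl'
    rwa [hf.list_map hl'']

end TerminalDigraph

namespace TerminalDigraph

variable {V V₁ V₂ : Type u}

/-- Both compositions only distribute the arcs, so each cut splits into a cut of each part. -/
theorem cutSize_eq_add {G₁ : TerminalDigraph V₁} {G₂ : TerminalDigraph V₂}
    {G : TerminalDigraph V} {f₁ : V₁ → V} {f₂ : V₂ → V}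
    (h : G.arcs = G₁.arcs.map (Prod.map f₁ f₁) + G₂.arcs.map (Prod.map f₂ f₂)) (P : Set V) :
    G.cutSize P = G₁.cutSize (f₁ ⁻¹' P) + G₂.cutSize (f₂ ⁻¹' P) := by
  classical
  simp only [cutSize]
  rw [h, Multiset.countP_add, Multiset.countP_map, Multiset.countP_map, Nat.cast_add,
    ← Multiset.countP_eq_card_filter, ← Multiset.countP_eq_card_filter]
  rfl

theorem cutSize_empty (G : TerminalDigraph V) : G.cutSize ∅ = 0 := by
  simp [cutSize]

theorem cutSize_univ (G : TerminalDigraph V) : G.cutSize Set.univ = 0 := by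
  simp [cutSize]

theorem preimage_insert_self {A B : Type*} {f : A → B} (hf : Function.Injective f) (x : A)
    (P : Set B) : f ⁻¹' insert (f x) P = insert x (f ⁻¹' P) := by
  ext y
  simp [hf.eq_iff]

theorem preimage_insert_of_forall_ne {A B : Type*} {f : A → B} {v : B} (hv : ∀ x, f x ≠ v)
    (P : Set B) : f ⁻¹' insert v P = f ⁻¹' P := by
  ext y
  simp [hv]

/-! ### Series composition -/

section Series

variable {G₁ : TerminalDigraph V₁} {G₂ : TerminalDigraph V₂} {G : TerminalDigraph V}
  {f₁ : V₁ → V} {f₂ : V₂ → V}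

/-- Until the sink of `G₁` is reached, the prefix contains no vertex of `G₂`, which contributes
nothing. -/
theorem IsSeriesComp.prefixCuts_left (h : IsSeriesComp G₁ G₂ G f₁ f₂) {l : List V₁}
    (hl : G₁.sink ∉ l) {P : Set V} (hP : f₂ ⁻¹' P = ∅) :
    G.prefixCuts P (l.map f₁) = G₁.prefixCuts (f₁ ⁻¹' P) l := by
  induction l generalizing P with
  | nil => simp [prefixCuts, cutSize_eq_add h.arcs_eq, hP, cutSize_empty]
  | cons x l ih =>
    have hx : ∀ y, f₂ y ≠ f₁ x := fun y hy =>
      hl (by simp [((h.identified_iff x y).1 hy.symm).1])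
    rw [List.map_cons, prefixCuts, prefixCuts, ih (fun hl' => hl (List.mem_cons_of_mem _ hl'))
      (by rw [preimage_insert_of_forall_ne hx, hP]), preimage_insert_self h.injective_left,
      cutSize_eq_add h.arcs_eq, hP, cutSize_empty, add_zero]

theorem IsSeriesComp.prefixCuts_right (h : IsSeriesComp G₁ G₂ G f₁ f₂) {l : List V₂}
    {P : Set V} (hP : f₁ ⁻¹' P = Set.univ) :
    G.prefixCuts P (l.map f₂) = G₂.prefixCuts (f₂ ⁻¹' P) l := by
  induction l generalizing P with
  | nil => simp [prefixCuts, cutSize_eq_add h.arcs_eq, hP, cutSize_univ]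
  | cons y l ih =>
    rw [List.map_cons, prefixCuts, prefixCuts, ih
      (Set.eq_univ_of_univ_subset (hP ▸ Set.preimage_mono (Set.subset_insert _ _))),
      preimage_insert_self h.injective_right, cutSize_eq_add h.arcs_eq, hP, cutSize_univ, zero_add]

theorem concatOrder_eq {s₁ t₁ : V₁} {s₂ t₂ : V₂} (l₁ : List V₁) (l₂ : List V₂) :
    concatOrder f₁ f₂ (s₁ :: (l₁ ++ [t₁])) (s₂ :: (l₂ ++ [t₂])) =
      f₁ s₁ :: ((l₁.map f₁ ++ f₁ t₁ :: l₂.map f₂) ++ [f₂ t₂]) := by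
  simp [concatOrder]

theorem IsSeriesComp.isTopologicalOrder_concatOrder (h : IsSeriesComp G₁ G₂ G f₁ f₂)
    (h₁ : G₁.IsSPD) (h₂ : G₂.IsSPD) {τ₁ : List V₁} {τ₂ : List V₂}
    (hτ₁ : G₁.IsTopologicalOrder τ₁) (hτ₂ : G₂.IsTopologicalOrder τ₂) :
    G.IsTopologicalOrder (concatOrder f₁ f₂ τ₁ τ₂) := by
  obtain ⟨l₁, rfl⟩ := h₁.exists_eq_cons_append hτ₁
  obtain ⟨l₂, rfl⟩ := h₂.exists_eq_cons_append hτ₂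
  obtain ⟨hnd₁, hmem₁, harc₁⟩ := isTopologicalOrder_iff.1 hτ₁
  obtain ⟨hnd₂, hmem₂, harc₂⟩ := isTopologicalOrder_iff.1 hτ₂
  have hc : f₁ G₁.sink = f₂ G₂.source := (h.identified_iff _ _).2 ⟨rfl, rfl⟩
  have hsub₁ : ((G₁.source :: (l₁ ++ [G₁.sink])).map f₁).Sublist (concatOrder f₁ f₂
      (G₁.source :: (l₁ ++ [G₁.sink])) (G₂.source :: (l₂ ++ [G₂.sink]))) :=
    List.sublist_append_left _ _
  have hsub₂ : ((G₂.source :: (l₂ ++ [G₂.sink])).map f₂).Sublist (concatOrder f₁ f₂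
      (G₁.source :: (l₁ ++ [G₁.sink])) (G₂.source :: (l₂ ++ [G₂.sink]))) := by
    -- The identified vertex may equally be listed with the second order.
    have : concatOrder f₁ f₂ (G₁.source :: (l₁ ++ [G₁.sink])) (G₂.source :: (l₂ ++ [G₂.sink])) =
        (G₁.source :: l₁).map f₁ ++ (G₂.source :: (l₂ ++ [G₂.sink])).map f₂ := by
      simp [concatOrder, hc]
    rw [this]
    exact List.sublist_append_right _ _
  refine isTopologicalOrder_iff.2 ⟨?_, fun v => ?_, fun a ha => ?_⟩
  · rw [concatOrder, List.nodup_append']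
    refine ⟨hnd₁.map h.injective_left, (hnd₂.map h.injective_right).tail, ?_⟩
    intro v hv₁ hv₂
    obtain ⟨x, -, rfl⟩ := List.mem_map.1 hv₁
    rw [List.map_cons, List.tail_cons] at hv₂
    obtain ⟨y, hy, hxy⟩ := List.mem_map.1 hv₂
    rw [((h.identified_iff x y).1 hxy.symm).2] at hy
    exact (List.nodup_cons.1 hnd₂).1 hy
  · rcases h.covers v with ⟨x, rfl⟩ | ⟨y, rfl⟩
    · exact hsub₁.subset (List.mem_map_of_mem (hmem₁ x))
    · exact hsub₂.subset (List.mem_map_of_mem (hmem₂ y))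
  · rw [h.arcs_eq, Multiset.mem_add] at ha
    rcases ha with ha | ha
    · obtain ⟨b, hb, rfl⟩ := Multiset.mem_map.1 ha
      exact ((harc₁ b hb).map f₁).trans hsub₁
    · obtain ⟨b, hb, rfl⟩ := Multiset.mem_map.1 ha
      exact ((harc₂ b hb).map f₂).trans hsub₂

theorem IsSeriesComp.cutSizeSeq_concatOrder (h : IsSeriesComp G₁ G₂ G f₁ f₂)
    (h₁ : G₁.IsSPD) (h₂ : G₂.IsSPD) {τ₁ : List V₁} {τ₂ : List V₂}
    (hτ₁ : G₁.IsTopologicalOrder τ₁) (hτ₂ : G₂.IsTopologicalOrder τ₂) :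
    G.cutSizeSeq (concatOrder f₁ f₂ τ₁ τ₂) = G₁.cutSizeSeq τ₁ ++ G₂.cutSizeSeq τ₂ := by
  have hτ := h.isTopologicalOrder_concatOrder h₁ h₂ hτ₁ hτ₂
  obtain ⟨l₁, rfl⟩ := h₁.exists_eq_cons_append hτ₁
  obtain ⟨l₂, rfl⟩ := h₂.exists_eq_cons_append hτ₂
  have hc : f₁ G₁.sink = f₂ G₂.source := (h.identified_iff _ _).2 ⟨rfl, rfl⟩
  rw [concatOrder_eq] at hτ ⊢
  rw [cutSizeSeq_eq_prefixCuts hτ, cutSizeSeq_eq_prefixCuts hτ₁, cutSizeSeq_eq_prefixCuts hτ₂,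
    prefixCuts_append_cons]
  have hl₁ : G₁.sink ∉ l₁ := by
    have := (List.nodup_cons.1 hτ₁.1).2
    rw [List.nodup_append'] at this
    exact fun h' => this.2.2 h' (by simp)
  have hne : ∀ x ∈ G₁.source :: l₁, ∀ y, f₂ y ≠ f₁ x := by
    intro x hx y hxy
    obtain ⟨rfl, -⟩ := (h.identified_iff x y).1 hxy.symm
    rcases List.mem_cons.1 hx with hx | hx
    · exact h₁.source_ne_sink hx.symm
    · exact hl₁ hx
  rw [h.prefixCuts_left hl₁, h.prefixCuts_right]
  · congr 2
    · ext x
      simp [h.injective_left.eq_iff]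
    · ext y
      simp only [Set.mem_preimage, Set.mem_insert_iff, Set.mem_union, Set.mem_singleton_iff, hc,
        h.injective_right.eq_iff]
      refine or_iff_left ?_
      rintro (h' | h')
      · exact hne _ (by simp) y h'
      · obtain ⟨x, hx, hxy⟩ := List.mem_map.1 h'
        exact hne x (List.mem_cons_of_mem _ hx) y hxy.symm
  · ext x
    have := hτ₁.2.1 x
    simp only [List.mem_cons, List.mem_append, List.not_mem_nil, or_false] at this
    rcases this with rfl | hx | rfl
    · simp
    · simp only [Set.mem_preimage, Set.mem_insert_iff, Set.mem_union, Set.mem_univ, iff_true]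
      exact .inr (.inr (List.mem_map_of_mem hx))
    · simp
  · ext y
    simpa using hne _ (by simp) y

/-- The restrictions to the parts end, respectively begin, at the identified vertex. So only
vertices of `G₁` precede it and only vertices of `G₂` follow it. -/
theorem IsSeriesComp.exists_eq_concatOrder (h : IsSeriesComp G₁ G₂ G f₁ f₂)
    (h₁ : G₁.IsSPD) (h₂ : G₂.IsSPD) {τ : List V} (hτ : G.IsTopologicalOrder τ) :
    ∃ τ₁ τ₂, G₁.IsTopologicalOrder τ₁ ∧ G₂.IsTopologicalOrder τ₂ ∧
      τ = concatOrder f₁ f₂ τ₁ τ₂ := by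
  classical
  obtain ⟨τ₁, hτ₁, hm₁⟩ := hτ.exists_restrict h.injective_left fun a ha => h.arc_left ha
  obtain ⟨τ₂, hτ₂, hm₂⟩ := hτ.exists_restrict h.injective_right fun a ha => h.arc_right ha
  refine ⟨τ₁, τ₂, hτ₁, hτ₂, ?_⟩
  obtain ⟨l₁, rfl⟩ := h₁.exists_eq_cons_append hτ₁
  obtain ⟨l₂, rfl⟩ := h₂.exists_eq_cons_append hτ₂
  have hc : f₁ G₁.sink = f₂ G₂.source := (h.identified_iff _ _).2 ⟨rfl, rfl⟩
  obtain ⟨A, B, rfl⟩ := List.append_of_mem (hτ.2.1 (f₁ G₁.sink))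
  rw [List.filter_append, List.filter_cons_of_pos (by simp)] at hm₁
  rw [List.filter_append, List.filter_cons_of_pos (by simp [hc])] at hm₂
  have hnd₁ := hτ₁.1.map h.injective_left
  have hnd₂ := hτ₂.1.map h.injective_right
  rw [← List.cons_append, List.map_append, List.nodup_append'] at hnd₁
  rw [List.map_cons] at hm₂ hnd₂
  rw [← List.cons_append, List.map_append] at hm₁
  rw [hc] at hm₂
  obtain ⟨hA₁, -, hB₁⟩ := (List.append_cons_inj_of_notMem
    (fun h' => hnd₁.2.2 h' (by simp)) (by simp)).1 hm₁
  obtain ⟨hA₂, -, hB₂⟩ := (List.append_cons_inj_of_notMem (x₁ := [])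
    (by simp) (List.nodup_cons.1 hnd₂).1).1 hm₂
  have hA : ∀ v ∈ A, v ∈ Set.range f₁ := fun v hv =>
    (h.covers v).resolve_right (by simpa using List.filter_eq_nil_iff.1 hA₂.symm v hv)
  have hB : ∀ v ∈ B, v ∈ Set.range f₂ := fun v hv =>
    (h.covers v).resolve_left (by simpa using List.filter_eq_nil_iff.1 hB₁.symm v hv)
  rw [List.filter_eq_self.2 fun v hv => by simpa using hA v hv] at hA₁
  rw [List.filter_eq_self.2 fun v hv => by simpa using hB v hv] at hB₂
  rw [concatOrder, List.map_cons (f := f₂), List.tail_cons, hB₂, ← hA₁]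
  simp

end Series

/-! ### Parallel composition -/

/-- `l` is an interleaving of the images of `l₁` under `f₁` and of `l₂` under `f₂`. -/
inductive IsShuffle (f₁ : V₁ → V) (f₂ : V₂ → V) : List V₁ → List V₂ → List V → Prop
  | nil : IsShuffle f₁ f₂ [] [] []
  | left {l₁ : List V₁} {l₂ : List V₂} {l : List V} (x : V₁) (h : IsShuffle f₁ f₂ l₁ l₂ l) :
      IsShuffle f₁ f₂ (x :: l₁) l₂ (f₁ x :: l)
  | right {l₁ : List V₁} {l₂ : List V₂} {l : List V} (y : V₂) (h : IsShuffle f₁ f₂ l₁ l₂ l) :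
      IsShuffle f₁ f₂ l₁ (y :: l₂) (f₂ y :: l)

section Parallel

variable {G₁ : TerminalDigraph V₁} {G₂ : TerminalDigraph V₂} {G : TerminalDigraph V}
  {f₁ : V₁ → V} {f₂ : V₂ → V}

theorem IsShuffle.perm {l₁ : List V₁} {l₂ : List V₂} {l : List V} (h : IsShuffle f₁ f₂ l₁ l₂ l) :
    l.Perm (l₁.map f₁ ++ l₂.map f₂) := by
  induction h with
  | nil => simp
  | left x _ ih => exact ih.cons _
  | right y _ ih => exact (ih.cons _).trans List.perm_middle.symm

theorem IsShuffle.sublist_left {l₁ : List V₁} {l₂ : List V₂} {l : List V}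
    (h : IsShuffle f₁ f₂ l₁ l₂ l) : (l₁.map f₁).Sublist l := by
  induction h with
  | nil => simp
  | left x _ ih => exact ih.cons_cons _
  | right y _ ih => exact ih.cons _

theorem IsShuffle.sublist_right {l₁ : List V₁} {l₂ : List V₂} {l : List V}
    (h : IsShuffle f₁ f₂ l₁ l₂ l) : (l₂.map f₂).Sublist l := by
  induction h with
  | nil => simp
  | left x _ ih => exact ih.cons _
  | right y _ ih => exact ih.cons_cons _

open Classical in
theorem isShuffle_of_filter (hf₁ : Function.Injective f₁) (hf₂ : Function.Injective f₂)
    {l₁ : List V₁} {l₂ : List V₂} {l : List V}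
    (hl : ∀ v ∈ l, ((∃ x, f₁ x = v) ∧ ∀ y, f₂ y ≠ v) ∨ ((∃ y, f₂ y = v) ∧ ∀ x, f₁ x ≠ v))
    (h₁ : l₁.map f₁ = l.filter (· ∈ Set.range f₁))
    (h₂ : l₂.map f₂ = l.filter (· ∈ Set.range f₂)) : IsShuffle f₁ f₂ l₁ l₂ l := by
  induction l generalizing l₁ l₂ with
  | nil =>
    simp only [List.filter_nil, List.map_eq_nil_iff] at h₁ h₂
    subst h₁ h₂
    exact .nil
  | cons v l ih =>
    have hl' := fun w hw => hl w (List.mem_cons_of_mem v hw)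
    rcases hl v (by simp) with ⟨⟨x, rfl⟩, hv⟩ | ⟨⟨y, rfl⟩, hv⟩
    · rw [List.filter_cons_of_pos (by simp)] at h₁
      rw [List.filter_cons_of_neg (by simpa using hv)] at h₂
      obtain ⟨x', l₁, rfl, hx, h₁'⟩ := List.map_eq_cons_iff.1 h₁
      obtain rfl := hf₁ hx
      exact .left _ (ih hl' h₁' h₂)
    · rw [List.filter_cons_of_pos (by simp)] at h₂
      rw [List.filter_cons_of_neg (by simpa using hv)] at h₁
      obtain ⟨y', l₂, rfl, hy, h₂'⟩ := List.map_eq_cons_iff.1 h₂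
      obtain rfl := hf₂ hy
      exact .right _ (ih hl' h₁ h₂')

theorem IsParallelComp.forall_ne_left (h : IsParallelComp G₁ G₂ G f₁ f₂) {x : V₁}
    (hx : x ≠ G₁.source ∧ x ≠ G₁.sink) (y : V₂) : f₂ y ≠ f₁ x := by
  intro hxy
  rcases (h.identified_iff x y).1 hxy.symm with h' | h'
  exacts [hx.1 h'.1, hx.2 h'.1]

theorem IsParallelComp.forall_ne_right (h : IsParallelComp G₁ G₂ G f₁ f₂) {y : V₂}
    (hy : y ≠ G₂.source ∧ y ≠ G₂.sink) (x : V₁) : f₁ x ≠ f₂ y := by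
  intro hxy
  rcases (h.identified_iff x y).1 hxy with h' | h'
  exacts [hy.1 h'.2, hy.2 h'.2]

/-- An interior vertex lies in one part only: adding it enlarges the prefix of that part and leaves
the other unchanged, which is a non-diagonal step. -/
theorem IsParallelComp.isNonDiagonalMerge_prefixCuts (h : IsParallelComp G₁ G₂ G f₁ f₂)
    {l₁ : List V₁} {l₂ : List V₂} {l : List V} (hl : IsShuffle f₁ f₂ l₁ l₂ l)
    (hl₁ : ∀ x ∈ l₁, x ≠ G₁.source ∧ x ≠ G₁.sink) (hl₂ : ∀ y ∈ l₂, y ≠ G₂.source ∧ y ≠ G₂.sink)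
    (P : Set V) :
    IsNonDiagonalMerge (G₁.prefixCuts (f₁ ⁻¹' P) l₁) (G₂.prefixCuts (f₂ ⁻¹' P) l₂)
      (G.prefixCuts P l) := by
  induction hl generalizing P with
  | nil =>
    simp only [prefixCuts, cutSize_eq_add h.arcs_eq]
    exact .single _ _
  | left x hl ih =>
    have := ih (fun z hz => hl₁ z (List.mem_cons_of_mem _ hz)) hl₂ (insert (f₁ x) P)
    rw [preimage_insert_self h.injective_left,
      preimage_insert_of_forall_ne (h.forall_ne_left (hl₁ x (by simp)))] at this
    rw [prefixCuts, prefixCuts, cutSize_eq_add h.arcs_eq]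
    exact this.cons_left (head?_prefixCuts _ _ _)
  | right y hl ih =>
    have := ih hl₁ (fun z hz => hl₂ z (List.mem_cons_of_mem _ hz)) (insert (f₂ y) P)
    rw [preimage_insert_self h.injective_right,
      preimage_insert_of_forall_ne (h.forall_ne_right (hl₂ y (by simp)))] at this
    rw [prefixCuts, prefixCuts, cutSize_eq_add h.arcs_eq]
    exact this.cons_right (head?_prefixCuts _ _ _)

/-- Each step of the merge path prescribes from which part the next vertex is taken. -/
theorem IsParallelComp.exists_isShuffle (h : IsParallelComp G₁ G₂ G f₁ f₂)
    {l₁ : List V₁} {l₂ : List V₂} {t : List ℤ}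
    (hl₁ : ∀ x ∈ l₁, x ≠ G₁.source ∧ x ≠ G₁.sink) (hl₂ : ∀ y ∈ l₂, y ≠ G₂.source ∧ y ≠ G₂.sink)
    {P : Set V}
    (ht : IsNonDiagonalMerge (G₁.prefixCuts (f₁ ⁻¹' P) l₁) (G₂.prefixCuts (f₂ ⁻¹' P) l₂) t) :
    ∃ l, IsShuffle f₁ f₂ l₁ l₂ l ∧ G.prefixCuts P l = t := by
  generalize hr : G₁.prefixCuts (f₁ ⁻¹' P) l₁ = r at ht
  generalize hs : G₂.prefixCuts (f₂ ⁻¹' P) l₂ = s at ht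
  have key := cutSize_eq_add h.arcs_eq
  induction ht generalizing P l₁ l₂ with
  | single a b =>
    cases l₁ with
    | cons x l₁ => simp [prefixCuts, prefixCuts_ne_nil] at hr
    | nil =>
    cases l₂ with
    | cons x l₁ => simp [prefixCuts, prefixCuts_ne_nil] at hs
    | nil =>
    simp only [prefixCuts, List.cons.injEq, and_true] at hr hs
    exact ⟨[], .nil, by simp [prefixCuts, key, hr, hs]⟩
  | stepLeft a a' b r s t _ ih =>
    cases l₁ with
    | nil => simp [prefixCuts] at hr
    | cons x l₁ =>
    rw [prefixCuts, List.cons.injEq] at hr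
    have hb := head?_prefixCuts G₂ (f₂ ⁻¹' P) l₂
    rw [hs] at hb
    obtain ⟨l, hl, rfl⟩ := ih (P := insert (f₁ x) P)
      (fun z hz => hl₁ z (List.mem_cons_of_mem _ hz)) hl₂
      (by rw [preimage_insert_self h.injective_left, hr.2])
      (by rw [preimage_insert_of_forall_ne (h.forall_ne_left (hl₁ x (by simp))), hs])
    refine ⟨f₁ x :: l, hl.left x, ?_⟩
    rw [prefixCuts, key, hr.1, ← Option.some.inj hb]
  | stepRight a b b' r s t _ ih =>
    cases l₂ with
    | nil => simp [prefixCuts] at hs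
    | cons y l₂ =>
    rw [prefixCuts, List.cons.injEq] at hs
    have ha := head?_prefixCuts G₁ (f₁ ⁻¹' P) l₁
    rw [hr] at ha
    obtain ⟨l, hl, rfl⟩ := ih (P := insert (f₂ y) P) hl₁
      (fun z hz => hl₂ z (List.mem_cons_of_mem _ hz))
      (by rw [preimage_insert_of_forall_ne (h.forall_ne_right (hl₂ y (by simp))), hr])
      (by rw [preimage_insert_self h.injective_right, hs.2])
    refine ⟨f₂ y :: l, hl.right y, ?_⟩
    rw [prefixCuts, key, hs.1, ← Option.some.inj ha]

theorem IsTopologicalOrder.ne_of_mem_interior {s t : V} {l : List V}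
    (h : G.IsTopologicalOrder (s :: (l ++ [t]))) {v : V} (hv : v ∈ l) : v ≠ s ∧ v ≠ t := by
  obtain ⟨h₁, h₂⟩ := List.nodup_cons.1 h.1
  refine ⟨?_, ?_⟩
  · rintro rfl
    exact h₁ (List.mem_append_left _ hv)
  · rintro rfl
    exact (List.nodup_append'.1 h₂).2.2 hv (by simp)

theorem IsParallelComp.preimage_source_left (h : IsParallelComp G₁ G₂ G f₁ f₂) :
    f₁ ⁻¹' {G.source} = {G₁.source} := by
  ext x
  simp [h.source_eq, h.injective_left.eq_iff]

theorem IsParallelComp.preimage_source_right (h : IsParallelComp G₁ G₂ G f₁ f₂) :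
    f₂ ⁻¹' {G.source} = {G₂.source} := by
  ext x
  simp [h.source_eq_right, h.injective_right.eq_iff]

theorem IsParallelComp.isTopologicalOrder_of_isShuffle (h : IsParallelComp G₁ G₂ G f₁ f₂)
    {l₁ : List V₁} {l₂ : List V₂} {l : List V}
    (hτ₁ : G₁.IsTopologicalOrder (G₁.source :: (l₁ ++ [G₁.sink])))
    (hτ₂ : G₂.IsTopologicalOrder (G₂.source :: (l₂ ++ [G₂.sink])))
    (hl : IsShuffle f₁ f₂ l₁ l₂ l) : G.IsTopologicalOrder (G.source :: (l ++ [G.sink])) := by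
  obtain ⟨hnd₁, hmem₁, harc₁⟩ := isTopologicalOrder_iff.1 hτ₁
  obtain ⟨hnd₂, hmem₂, harc₂⟩ := isTopologicalOrder_iff.1 hτ₂
  have hsub₁ : ((G₁.source :: (l₁ ++ [G₁.sink])).map f₁).Sublist
      (G.source :: (l ++ [G.sink])) := by
    rw [h.source_eq, h.sink_eq, List.map_cons, List.map_append]
    exact (hl.sublist_left.append (List.Sublist.refl _)).cons_cons _
  have hsub₂ : ((G₂.source :: (l₂ ++ [G₂.sink])).map f₂).Sublist
      (G.source :: (l ++ [G.sink])) := by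
    rw [h.source_eq_right, h.sink_eq_right, List.map_cons, List.map_append]
    exact (hl.sublist_right.append (List.Sublist.refl _)).cons_cons _
  refine isTopologicalOrder_iff.2 ⟨?_, fun v => ?_, fun a ha => ?_⟩
  -- Counting the terminals with `G₁` only leaves two lists with disjoint images.
  · have hp : (G.source :: (l ++ [G.sink])).Perm
        ((G₁.source :: (l₁ ++ [G₁.sink])).map f₁ ++ l₂.map f₂) := by
      rw [h.source_eq, h.sink_eq, List.map_cons, List.map_append, List.cons_append,
        List.append_assoc]
      refine List.Perm.cons _ ((hl.perm.append_right _).trans ?_)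
      rw [List.append_assoc]
      exact List.Perm.append_left _ List.perm_append_comm
    rw [hp.nodup_iff, List.nodup_append']
    refine ⟨hnd₁.map h.injective_left, ?_, ?_⟩
    · exact ((List.nodup_append'.1 (List.nodup_cons.1 hnd₂).2).1).map h.injective_right
    · intro v hv₁ hv₂
      obtain ⟨x, -, rfl⟩ := List.mem_map.1 hv₁
      obtain ⟨y, hy, hxy⟩ := List.mem_map.1 hv₂
      exact h.forall_ne_right (hτ₂.ne_of_mem_interior hy) x hxy.symm
  · rcases h.covers v with ⟨x, rfl⟩ | ⟨y, rfl⟩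
    · exact hsub₁.subset (List.mem_map_of_mem (hmem₁ x))
    · exact hsub₂.subset (List.mem_map_of_mem (hmem₂ y))
  · rw [h.arcs_eq, Multiset.mem_add] at ha
    rcases ha with ha | ha
    · obtain ⟨b, hb, rfl⟩ := Multiset.mem_map.1 ha
      exact ((harc₁ b hb).map f₁).trans hsub₁
    · obtain ⟨b, hb, rfl⟩ := Multiset.mem_map.1 ha
      exact ((harc₂ b hb).map f₂).trans hsub₂

/-- Every non-diagonal merge of the cut-size sequences of two topological orders is the cut-size
sequence of a topological order of the parallel composition. -/
theorem IsParallelComp.exists_of_isNonDiagonalMerge (h : IsParallelComp G₁ G₂ G f₁ f₂)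
    (h₁ : G₁.IsSPD) (h₂ : G₂.IsSPD) {τ₁ : List V₁} {τ₂ : List V₂}
    (hτ₁ : G₁.IsTopologicalOrder τ₁) (hτ₂ : G₂.IsTopologicalOrder τ₂) {t : List ℤ}
    (ht : IsNonDiagonalMerge (G₁.cutSizeSeq τ₁) (G₂.cutSizeSeq τ₂) t) :
    ∃ τ, G.IsTopologicalOrder τ ∧ G.cutSizeSeq τ = t := by
  obtain ⟨l₁, rfl⟩ := h₁.exists_eq_cons_append hτ₁
  obtain ⟨l₂, rfl⟩ := h₂.exists_eq_cons_append hτ₂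
  rw [cutSizeSeq_eq_prefixCuts hτ₁, cutSizeSeq_eq_prefixCuts hτ₂, ← h.preimage_source_left,
    ← h.preimage_source_right] at ht
  obtain ⟨l, hl, rfl⟩ := h.exists_isShuffle (fun x hx => hτ₁.ne_of_mem_interior hx)
    (fun y hy => hτ₂.ne_of_mem_interior hy) ht
  have hτ := h.isTopologicalOrder_of_isShuffle hτ₁ hτ₂ hl
  exact ⟨_, hτ, cutSizeSeq_eq_prefixCuts hτ⟩

/-- The cut-size sequence of a topological order of a parallel composition is a non-diagonal merge
of cut-size sequences of the parts. -/
theorem IsParallelComp.exists_isNonDiagonalMerge (h : IsParallelComp G₁ G₂ G f₁ f₂)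
    (h₁ : G₁.IsSPD) (h₂ : G₂.IsSPD) {τ : List V} (hτ : G.IsTopologicalOrder τ) :
    ∃ τ₁ τ₂, G₁.IsTopologicalOrder τ₁ ∧ G₂.IsTopologicalOrder τ₂ ∧
      IsNonDiagonalMerge (G₁.cutSizeSeq τ₁) (G₂.cutSizeSeq τ₂) (G.cutSizeSeq τ) := by
  classical
  obtain ⟨τ₁, hτ₁, hm₁⟩ := hτ.exists_restrict h.injective_left fun a ha => h.arc_left ha
  obtain ⟨τ₂, hτ₂, hm₂⟩ := hτ.exists_restrict h.injective_right fun a ha => h.arc_right ha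
  refine ⟨τ₁, τ₂, hτ₁, hτ₂, ?_⟩
  obtain ⟨l₁, rfl⟩ := h₁.exists_eq_cons_append hτ₁
  obtain ⟨l₂, rfl⟩ := h₂.exists_eq_cons_append hτ₂
  obtain ⟨l, rfl⟩ := (IsSPD.parallel G₁ G₂ G f₁ f₂ h₁ h₂ h).exists_eq_cons_append hτ
  rw [cutSizeSeq_eq_prefixCuts hτ₁, cutSizeSeq_eq_prefixCuts hτ₂, cutSizeSeq_eq_prefixCuts hτ,
    ← h.preimage_source_left, ← h.preimage_source_right]
  refine h.isNonDiagonalMerge_prefixCuts (isShuffle_of_filter h.injective_left h.injective_right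
    (fun v hv => ?_) ?_ ?_) (fun x hx => hτ₁.ne_of_mem_interior hx)
    (fun y hy => hτ₂.ne_of_mem_interior hy) _
  · obtain ⟨hs, ht⟩ := hτ.ne_of_mem_interior hv
    rcases h.covers v with ⟨x, rfl⟩ | ⟨y, rfl⟩
    · refine .inl ⟨⟨x, rfl⟩, h.forall_ne_left ⟨?_, ?_⟩⟩
      · rintro rfl; exact hs h.source_eq.symm
      · rintro rfl; exact ht h.sink_eq.symm
    · refine .inr ⟨⟨y, rfl⟩, h.forall_ne_right ⟨?_, ?_⟩⟩
      · rintro rfl; exact hs h.source_eq_right.symm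
      · rintro rfl; exact ht h.sink_eq_right.symm
  · rw [h.source_eq, h.sink_eq] at hm₁
    simpa using hm₁
  · rw [h.source_eq_right, h.sink_eq_right] at hm₂
    simpa using hm₂

end Parallel

/-! ### Dominating orders -/

section Dominating

variable {G₁ : TerminalDigraph V₁} {G₂ : TerminalDigraph V₂} {G : TerminalDigraph V}
  {f₁ : V₁ → V} {f₂ : V₂ → V}

theorem IsSPD.cutSizeSeq_ne_nil (h : G.IsSPD) {τ : List V} (hτ : G.IsTopologicalOrder τ) :
    G.cutSizeSeq τ ≠ [] := by
  obtain ⟨l, rfl⟩ := h.exists_eq_cons_append hτ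
  rw [cutSizeSeq_eq_prefixCuts hτ]
  exact prefixCuts_ne_nil _ _ _

theorem IsSPD.isDominatingOrder_iff (h : G.IsSPD) {τ : List V} :
    G.IsDominatingOrder τ ↔ G.IsTopologicalOrder τ ∧
      ∀ σ, G.IsTopologicalOrder σ → WalkDominates (G.cutSizeSeq τ) (G.cutSizeSeq σ) := by
  refine and_congr_right fun hτ => ⟨fun hd σ hσ => ?_, ?_⟩
  · exact (hd _ ⟨σ, hσ, rfl⟩).walkDominates (h.cutSizeSeq_ne_nil hτ) (h.cutSizeSeq_ne_nil hσ)
  · rintro hd _ ⟨σ, hσ, rfl⟩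
    exact (hd σ hσ).dominates

theorem IsSeriesComp.isDominatingOrder_concatOrder (h : IsSeriesComp G₁ G₂ G f₁ f₂)
    (h₁ : G₁.IsSPD) (h₂ : G₂.IsSPD) {τ₁ : List V₁} {τ₂ : List V₂}
    (hτ₁ : G₁.IsDominatingOrder τ₁) (hτ₂ : G₂.IsDominatingOrder τ₂) :
    G.IsDominatingOrder (concatOrder f₁ f₂ τ₁ τ₂) := by
  rw [h₁.isDominatingOrder_iff] at hτ₁
  rw [h₂.isDominatingOrder_iff] at hτ₂
  refine (IsSPD.series G₁ G₂ G f₁ f₂ h₁ h₂ h).isDominatingOrder_iff.2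
    ⟨h.isTopologicalOrder_concatOrder h₁ h₂ hτ₁.1 hτ₂.1, fun σ hσ => ?_⟩
  obtain ⟨σ₁, σ₂, hσ₁, hσ₂, rfl⟩ := h.exists_eq_concatOrder h₁ h₂ hσ
  rw [h.cutSizeSeq_concatOrder h₁ h₂ hτ₁.1 hτ₂.1, h.cutSizeSeq_concatOrder h₁ h₂ hσ₁ hσ₂]
  exact (hτ₁.2 σ₁ hσ₁).append (hτ₂.2 σ₂ hσ₂)

theorem IsParallelComp.exists_dominatesSet (h : IsParallelComp G₁ G₂ G f₁ f₂)
    (h₁ : G₁.IsSPD) (h₂ : G₂.IsSPD) {τ₁ : List V₁} {τ₂ : List V₂}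
    (hτ₁ : G₁.IsTopologicalOrder τ₁) (hτ₂ : G₂.IsTopologicalOrder τ₂) :
    ∃ τ : List V, G.IsTopologicalOrder τ ∧ DominatesSet (G.cutSizeSeq τ)
      (nonDiagonalMerges (G₁.cutSizeSeq τ₁) (G₂.cutSizeSeq τ₂)) := by
  obtain ⟨t, ht, hd⟩ :=
    hasDominatingMerge (h₁.cutSizeSeq_ne_nil hτ₁) (h₂.cutSizeSeq_ne_nil hτ₂)
  obtain ⟨τ, hτ, rfl⟩ := h.exists_of_isNonDiagonalMerge h₁ h₂ hτ₁ hτ₂ ht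
  exact ⟨τ, hτ, fun t' ht' => (hd t' ht').dominates⟩

/-- The sequence of any order `σ` is a merge of the sequences of its restrictions, hence dominated
by some merge `t` of the two dominating sequences, which `τ` dominates. -/
theorem IsParallelComp.isDominatingOrder (h : IsParallelComp G₁ G₂ G f₁ f₂)
    (h₁ : G₁.IsSPD) (h₂ : G₂.IsSPD) {τ₁ : List V₁} {τ₂ : List V₂}
    (hτ₁ : G₁.IsDominatingOrder τ₁) (hτ₂ : G₂.IsDominatingOrder τ₂) {τ : List V}
    (hτ : G.IsTopologicalOrder τ) (hd : DominatesSet (G.cutSizeSeq τ)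
      (nonDiagonalMerges (G₁.cutSizeSeq τ₁) (G₂.cutSizeSeq τ₂))) : G.IsDominatingOrder τ := by
  rw [h₁.isDominatingOrder_iff] at hτ₁
  rw [h₂.isDominatingOrder_iff] at hτ₂
  have hG := IsSPD.parallel G₁ G₂ G f₁ f₂ h₁ h₂ h
  refine hG.isDominatingOrder_iff.2 ⟨hτ, fun σ hσ => ?_⟩
  obtain ⟨σ₁, σ₂, hσ₁, hσ₂, hm⟩ := h.exists_isNonDiagonalMerge h₁ h₂ hσ
  obtain ⟨t, ht, hw⟩ := hm.mono (hτ₁.2 σ₁ hσ₁) (hτ₂.2 σ₂ hσ₂)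
  exact ((hd t ht).walkDominates (hG.cutSizeSeq_ne_nil hτ) ht.ne_nil.2.2).trans hw

theorem IsSingleArc.isDominatingOrder (h : G.IsSingleArc) :
    G.IsDominatingOrder [G.source, G.sink] := by
  refine (IsSPD.arc G h).isDominatingOrder_iff.2 ⟨isTopologicalOrder_iff.2
    ⟨by simpa using h.1, by simpa using h.2.1, by simp [h.2.2]⟩, fun σ hσ => ?_⟩
  have hne := (IsSPD.arc G h).cutSizeSeq_ne_nil hσ
  obtain ⟨l, rfl⟩ := (IsSPD.arc G h).exists_eq_cons_append hσ
  cases l with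
  | nil => exact .refl hne
  | cons v l =>
    have := hσ.ne_of_mem_interior (v := v) (by simp)
    exact ((h.2.1 v).elim this.1 this.2).elim

/-- Every series parallel digraph has a dominating topological order. -/
theorem IsSPD.exists_isDominatingOrder (h : G.IsSPD) : ∃ τ : List V, G.IsDominatingOrder τ := by
  induction h with
  | arc G h => exact ⟨_, h.isDominatingOrder⟩
  | series G₁ G₂ G f₁ f₂ h₁ h₂ h ih₁ ih₂ =>
    obtain ⟨τ₁, hτ₁⟩ := ih₁
    obtain ⟨τ₂, hτ₂⟩ := ih₂
    exact ⟨_, h.isDominatingOrder_concatOrder h₁ h₂ hτ₁ hτ₂⟩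
  | parallel G₁ G₂ G f₁ f₂ h₁ h₂ h ih₁ ih₂ =>
    obtain ⟨τ₁, hτ₁⟩ := ih₁
    obtain ⟨τ₂, hτ₂⟩ := ih₂
    obtain ⟨τ, hτ, hd⟩ := h.exists_dominatesSet h₁ h₂ hτ₁.1 hτ₂.1
    exact ⟨τ, h.isDominatingOrder h₁ h₂ hτ₁ hτ₂ hτ hd⟩

end Dominating

end TerminalDigraph

theorem mainTheorem5 {V : Type u} (G : TerminalDigraph V) (hG : G.IsSPD)
    (hpar : G.NoParallelArcs) :
    (∃ τ : List V, G.IsDominatingOrder τ) ∧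
    ∀ (V₁ V₂ : Type u) (G₁ : TerminalDigraph V₁) (G₂ : TerminalDigraph V₂),
      G₁.IsSPD → G₂.IsSPD →
      ∀ (τ₁ : List V₁) (τ₂ : List V₂), G₁.IsDominatingOrder τ₁ → G₂.IsDominatingOrder τ₂ →
      ∀ (f₁ : V₁ → V) (f₂ : V₂ → V),
        (TerminalDigraph.IsSeriesComp G₁ G₂ G f₁ f₂ →
          G.IsDominatingOrder (TerminalDigraph.concatOrder f₁ f₂ τ₁ τ₂)) ∧
        (TerminalDigraph.IsParallelComp G₁ G₂ G f₁ f₂ →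
          (∃ τ : List V, G.IsTopologicalOrder τ ∧
            DominatesSet (G.cutSizeSeq τ)
              (nonDiagonalMerges (G₁.cutSizeSeq τ₁) (G₂.cutSizeSeq τ₂))) ∧
          ∀ τ : List V, G.IsTopologicalOrder τ →
            DominatesSet (G.cutSizeSeq τ)
              (nonDiagonalMerges (G₁.cutSizeSeq τ₁) (G₂.cutSizeSeq τ₂)) →
            G.IsDominatingOrder τ) := by

  refine ⟨hG.exists_isDominatingOrder, ?_⟩
  intro V₁ V₂ G₁ G₂ h₁ h₂ τ₁ τ₂ hτ₁ hτ₂ f₁ f₂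
  exact ⟨fun h => h.isDominatingOrder_concatOrder h₁ h₂ hτ₁ hτ₂, fun h =>
    ⟨h.exists_dominatesSet h₁ h₂ hτ₁.1 hτ₂.1, fun _ => h.isDominatingOrder h₁ h₂ hτ₁ hτ₂⟩⟩
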